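/- Let $m>0$ and $\beta>0$. On Minkowski spacetime $M=\mathbb{R}\times\mathbb{R}^3$, with points $x=(t_x,\mathbf{x})$ and metric of signature $(-+++)$, let $\omega_2^\beta$ be the two-point function of the extremal KMS state at inverse temperature $\beta$ of the free scalar field of mass $m$, i.e. the bidistribution $$\omega_2^\beta(x,y)=\frac{1}{(2\pi)^3}\int_{\mathbb{R}^3}d^3\mathbf{k}\left(b_+(k)\frac{e^{i\omega_{\mathbf k}(t_x-t_y)}}{2\omega_{\mathbf k}}+b_-(k)\frac{e^{-i\omega_{\mathbf k}(t_x-t_y)}}{2\omega_{\mathbf k}}\right)e^{-i\mathbf{k}\cdot(\mathbf{x}-\mathbf{y})},$$ where $\omega_{\mathbf k}=\sqrt{|\mathbf k|^2+m^2}$, $b_+(k)=(1-e^{-\beta\omega_{\mathbf k}})^{-1}$, $b_-(k)=e^{-\beta\omega_{\mathbf k}}b_+(k)$, and the formula is understood by pairing the integrand with a test function $f\in C_c^\infty(M\times M)$ in $(x,y)$ before integrating over $\mathbf{k}$. For every such $f$ the resulting integral over $\mathbf{k}$ converges absolutely. On the open set of pairs $(x,y)$ for which $y-x$ is timelike and future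 pointing, $\omega_2^\beta$ is given by a smooth function, also denoted $\omega_2^\beta$. For every multi-index $\alpha\in\mathbb{N}^8$ and all $x,y$ with $y-x$ timelike and future pointing there is a constant $C_\alpha>0$ such that $$\left|D^{(\alpha)}\omega_2^\beta(x;t_y+t,\mathbf{y})\right|\le\frac{C_\alpha}{t^{3/2}}\qquad\text{for all } t>1,$$ where $D^{(\alpha)}$ is the composition of the partial derivatives of order $\alpha_i$ in the $i$-th of the eight coordinates of $M\times M$. Moreover, $C_\alpha$ can be chosen uniformly for $(x,y)$ in any compact set of pairs with $y-x$ timelike and future pointing. -/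

import Mathlib

open scoped ContDiff
open MeasureTheory

noncomputable section

namespace ThermalField

/-- Euclidean three-space. -/
abbrev Space : Type := EuclideanSpace ℝ (Fin 3)

/-- Minkowski spacetime in standard coordinates `(t, x)`. -/
abbrev Spacetime : Type := ℝ × Space

/-- The quadratic form of the Minkowski metric of signature `(-+++)`. -/
def minkowskiSq (v : Spacetime) : ℝ := -v.1 ^ 2 + ∑ i, v.2 i ^ 2

/-- `v` is timelike and future pointing. -/
def FutureTimelike (v : Spacetime) : Prop := minkowskiSq v < 0 ∧ 0 < v.1

/-- The pairs `(x, y)` of points for which `y - x` is timelike and future pointing. -/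
def futurePairs : Set (Spacetime × Spacetime) := {z | FutureTimelike (z.2 - z.1)}

/-- The one-particle energy `√(|k|² + m²)`. -/
def energy (m : ℝ) (k : Space) : ℝ := Real.sqrt (‖k‖ ^ 2 + m ^ 2)

/-- The factor `b₊(k) = 1 / (1 - exp (-β ω_k))`. -/
def bPlus (m β : ℝ) (k : Space) : ℝ := (1 - Real.exp (-(energy m k * β)))⁻¹

/-- The factor `b₋(k) = exp (-β ω_k) b₊(k)`. -/
def bMinus (m β : ℝ) (k : Space) : ℝ := Real.exp (-(β * energy m k)) * bPlus m β k

/-- The integrand, at momentum `k`, of the formal mode integral for the thermal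
two-point function at the pair of points `(x, y)`. -/
def thermalMode (m β : ℝ) (k : Space) (x y : Spacetime) : ℂ :=
  ((bPlus m β k : ℂ) *
      (Complex.exp (Complex.I * (energy m k * (x.1 - y.1) : ℝ)) / (2 * energy m k : ℝ)) +
    (bMinus m β k : ℂ) *
      (Complex.exp (-(Complex.I * (energy m k * (x.1 - y.1) : ℝ))) / (2 * energy m k : ℝ))) *
    Complex.exp (-(Complex.I * (inner ℝ k (x.2 - y.2) : ℝ)))

/-- Test functions on `M × M`: smooth with compact support. -/
def IsTest (f : Spacetime × Spacetime → ℂ) : Prop := ContDiff ℝ ∞ f ∧ HasCompactSupport f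

/-- The mode of momentum `k`, smeared with `f`. -/
def smearedMode (m β : ℝ) (f : Spacetime × Spacetime → ℂ) (k : Space) : ℂ :=
  ∫ z, thermalMode m β k z.1 z.2 * f z

/-- The thermal two-point function as a bidistribution. Its mode integral does not converge
absolutely pointwise, so it is paired with the test function `f` on `M × M` before the
integration over the momentum. -/
def thermalTwoPoint (m β : ℝ) (f : Spacetime × Spacetime → ℂ) : ℂ :=
  (1 / (2 * Real.pi) ^ 3 : ℝ) * ∫ k : Space, smearedMode m β f k

/-- The eight coordinate directions of `M × M`. -/
def direction : Fin 8 → Spacetime × Spacetime :=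
  ![((1, 0), 0),
    ((0, EuclideanSpace.single 0 1), 0),
    ((0, EuclideanSpace.single 1 1), 0),
    ((0, EuclideanSpace.single 2 1), 0),
    (0, (1, 0)),
    (0, (0, EuclideanSpace.single 0 1)),
    (0, (0, EuclideanSpace.single 1 1)),
    (0, (0, EuclideanSpace.single 2 1))]

/-- The partial derivative in the `i`-th coordinate of `M × M`. -/
def partialD (i : Fin 8) (g : Spacetime × Spacetime → ℂ) : Spacetime × Spacetime → ℂ :=
  fun z => fderiv ℝ g z (direction i)

/-- `D^α`: the composition over `i` of the partial derivatives of order `α i` in the `i`-th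
coordinate of `M × M`. -/
def multiD (α : Fin 8 → ℕ) (g : Spacetime × Spacetime → ℂ) : Spacetime × Spacetime → ℂ :=
  (List.finRange 8).foldr (fun i h => (partialD i)^[α i] h) g

end ThermalField

end

/-! In polar coordinates k = p n, with the energy ω = m + ζ as variable, p² dp / (2ω) becomes p dω /
2 with p = √(ζ(ζ + 2m)). For y - x future timelike, with time difference τ and spatial separation s
along n, the positive-frequency integrand √(ζ(ζ + 2m)) B(m + ζ) exp(-iτ(m + ζ) + ips) / 2 is
holomorphic in the open fourth quadrant, and there Im p differs from Im ζ by at most m. Since |s| <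
τ, the contour ζ > 0 can be turned to ζ = -iu, where the integrand decays like exp(-(τ - |s|)u)
(`integral_radial`). The Bose factors do not interfere, as their poles lie on the imaginary axis of
ω. The negative-frequency part is the complex conjugate of an integral of the same kind.

On the rotated contour everything converges absolutely. Derivatives only bring down polynomial
factors, which gives smoothness, and translating y by t in time inserts exp(-tu). The amplitude is
O(√u) at the threshold u = 0, so the integral is bounded by a multiple of ∫ √u exp(-tu) du = Γ(3/2)
t^(-3/2) (`IsRayAmplitude.decay`). Polynomial factors keep the √u and are absorbed by the original
timelike gap, which is bounded below on compact sets; hence the same rate holds for every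
derivative, uniformly.

The undamped mode integral does not converge absolutely before smearing. A factor exp(-εω) justifies
Fubini and the rotation, and ε → 0 is taken by dominated convergence on both sides
(`integral_smearedMode_eq`). On the momentum side the dominating function comes from integration by
parts in the spatial variables (`integrable_smearedMode`). -/

noncomputable section

namespace ThermalField

open Complex Set Filter Topology

/-! ### Momentum as a function of complex energy -/

/-- The principal square root of `ζ (ζ + 2m) = ω² - m²`, with `ω = m + ζ`. -/
def momentum (m : ℝ) (ζ : ℂ) : ℂ := (ζ * (ζ + 2 * m)) ^ (1 / 2 : ℂ)

lemma momentum_sq (m : ℝ) (ζ : ℂ) : momentum m ζ ^ 2 = ζ * (ζ + 2 * m) := by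
  unfold momentum
  rw [one_div]
  exact_mod_cast Complex.cpow_nat_inv_pow (ζ * (ζ + 2 * m)) two_ne_zero

lemma momentum_re_nonneg (m : ℝ) (ζ : ℂ) : 0 ≤ (momentum m ζ).re := by
  unfold momentum
  set z := ζ * (ζ + 2 * m)
  by_cases hz : z = 0
  · rw [hz]; simp
  · rw [Complex.cpow_def_of_ne_zero hz, Complex.exp_re]
    refine mul_nonneg (Real.exp_pos _).le (Real.cos_nonneg_of_mem_Icc ?_)
    have h1 := Complex.neg_pi_lt_arg z
    have h2 := Complex.arg_le_pi z
    have : (Complex.log z * (1 / 2)).im = z.arg / 2 := by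
      simp [Complex.mul_im, Complex.log_im]; ring
    rw [this]
    constructor <;> linarith

/-- With ω = ζ + m and P the momentum, (P - ω)(P + ω) = -m², while |P + ω| ≥ Re(P + ω) ≥ m because
both real parts have a sign. -/
lemma norm_momentum_sub_le {m : ℝ} (hm : 0 < m) {ζ : ℂ} (hζ : 0 ≤ ζ.re) :
    ‖momentum m ζ - (ζ + m)‖ ≤ m := by
  have h1 : (momentum m ζ - (ζ + m)) * (momentum m ζ + (ζ + m)) = -(m : ℂ) ^ 2 := by
    have := momentum_sq m ζ
    linear_combination this
  have h2 : ‖momentum m ζ - (ζ + m)‖ * ‖momentum m ζ + (ζ + m)‖ = m ^ 2 := by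
    rw [← norm_mul, h1]; simp
  have h3 : m ≤ ‖momentum m ζ + (ζ + m)‖ := by
    refine le_trans ?_ (Complex.re_le_norm _)
    have := momentum_re_nonneg m ζ
    simp; linarith
  nlinarith [norm_nonneg (momentum m ζ - (ζ + m))]

/-- The coefficient 1 of |Im ζ| is essential: it makes τ > |s| exactly what the contour rotation
needs. -/
lemma abs_im_momentum_le {m : ℝ} (hm : 0 < m) {ζ : ℂ} (hζ : 0 ≤ ζ.re) :
    |(momentum m ζ).im| ≤ |ζ.im| + m := by
  have h1 := (Complex.abs_im_le_norm _).trans (norm_momentum_sub_le hm hζ)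
  have h2 : (momentum m ζ).im = (momentum m ζ - (ζ + m)).im + ζ.im := by simp
  rw [h2]
  linarith [abs_add_le (momentum m ζ - (ζ + m)).im ζ.im]

lemma norm_momentum_le {m : ℝ} (hm : 0 < m) {ζ : ℂ} (hζ : 0 ≤ ζ.re) :
    ‖momentum m ζ‖ ≤ ‖ζ‖ + 2 * m := by
  have h1 := norm_momentum_sub_le hm hζ
  have h2 := norm_le_norm_add_norm_sub' (momentum m ζ) (ζ + m)
  have h3 : ‖ζ + (m : ℂ)‖ ≤ ‖ζ‖ + m := by
    simpa [abs_of_pos hm] using norm_add_le ζ (m : ℂ)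
  linarith

lemma momentum_ofReal {m a : ℝ} (hm : 0 < m) (ha : 0 ≤ a) :
    momentum m a = (Real.sqrt (a * (a + 2 * m)) : ℝ) := by
  unfold momentum
  rw [Real.sqrt_eq_rpow, Complex.ofReal_cpow (by positivity)]
  push_cast; rfl

lemma continuousAt_momentum {m : ℝ} (hm : 0 < m) {ζ : ℂ} (h1 : 0 ≤ ζ.re) :
    ContinuousAt (momentum m) ζ := by
  -- The radicand has imaginary part 2 Im ζ (Re ζ + m), so it can be real only for real ζ, where it
  -- is nonnegative. The threshold ζ = 0 is allowed since the exponent 1/2 has positive real part.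
  have h := Complex.continuousAt_cpow_const_of_re_pos (z := ζ * (ζ + 2 * m)) (w := 1 / 2)
    (by
      by_cases h : ζ.im = 0
      · left; simp [h]; positivity
      · by_cases h' : ζ.im * (ζ.re + m) = 0
        · rcases mul_eq_zero.1 h' with h' | h'
          · exact absurd h' h
          · linarith
        · right; simp; intro h''; apply h'; linarith) (by norm_num)
  exact ContinuousAt.comp (f := fun ζ : ℂ => ζ * (ζ + 2 * m)) h (by fun_prop)

lemma differentiableAt_momentum {m : ℝ} (hm : 0 < m) {ζ : ℂ} (h1 : 0 < ζ.re) (h2 : ζ.im < 0) :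
    DifferentiableAt ℂ (momentum m) ζ := by
  unfold momentum
  refine DifferentiableAt.cpow (by fun_prop) (by fun_prop) ?_
  right
  simp
  have : ζ.im * (ζ.re + m) < 0 := mul_neg_of_neg_of_pos h2 (by linarith)
  intro h; linarith

/-- The vanishing like √u at u = 0 is the source of the exponent 3/2 in the decay. -/
lemma norm_momentum_vertical_le {m : ℝ} (hm : 0 < m) {u : ℝ} (hu : 0 ≤ u) :
    ‖momentum m (-(u * I))‖ ≤ Real.sqrt u * (u + 2 * m + 1) := by
  have h1 : ‖momentum m (-(u * I))‖ ^ 2 = u * ‖-(u * I) + 2 * (m : ℂ)‖ := by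
    rw [← norm_pow, momentum_sq, norm_mul]
    simp [abs_of_nonneg hu]
  have h2 : ‖-(u * I) + 2 * (m : ℂ)‖ ≤ u + 2 * m := by
    refine (norm_add_le _ _).trans ?_
    simp [abs_of_nonneg hu, abs_of_pos hm]
  refine abs_le_of_sq_le_sq' ?_ (by positivity) |>.2
  rw [h1, mul_pow, Real.sq_sqrt hu]
  refine mul_le_mul_of_nonneg_left ?_ hu
  nlinarith

lemma measurable_momentum (m : ℝ) : Measurable (momentum m) := by
  unfold momentum; fun_prop

/-! ### Contour rotation -/

/-- Rotation of a contour by a right angle in the fourth quadrant. -/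
theorem integral_Ioi_eq_integral_vertical {f : ℂ → ℂ}
    (hc : ContinuousOn f {ζ | 0 ≤ ζ.re ∧ ζ.im ≤ 0})
    (hd : ∀ ζ : ℂ, 0 < ζ.re → ζ.im < 0 → DifferentiableAt ℂ f ζ)
    {C ε δ : ℝ} (hε : 0 < ε) (hδ : 0 < δ)
    (hb : ∀ ζ : ℂ, 0 ≤ ζ.re → ζ.im ≤ 0 → ‖f ζ‖ ≤ C * Real.exp (-ε * ζ.re + δ * ζ.im)) :
    ∫ a in Ioi (0 : ℝ), f a = -I * ∫ u in Ioi (0 : ℝ), f (-(u * I)) := by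
  have hC : 0 ≤ C := by
    have := (norm_nonneg _).trans (hb 0 le_rfl le_rfl)
    simpa using this
  have int1 : IntegrableOn (fun a : ℝ => f a) (Ioi 0) := by
    refine Integrable.mono' (g := fun a => C * Real.exp (-ε * a))
      ((exp_neg_integrableOn_Ioi 0 hε).const_mul C) ?_ ?_
    · refine ContinuousOn.aestronglyMeasurable ?_ measurableSet_Ioi
      refine hc.comp (by fun_prop) ?_
      intro x hx; simpa using hx.le
    · refine (ae_restrict_mem measurableSet_Ioi).mono fun a ha => ?_
      simpa using hb a (by simpa using (mem_Ioi.1 ha).le) (by simp)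
  have int2 : IntegrableOn (fun u : ℝ => f (-(u * I))) (Ioi 0) := by
    refine Integrable.mono' (g := fun a => C * Real.exp (-δ * a))
      ((exp_neg_integrableOn_Ioi 0 hδ).const_mul C) ?_ ?_
    · refine ContinuousOn.aestronglyMeasurable ?_ measurableSet_Ioi
      refine hc.comp (by fun_prop) ?_
      intro x hx; simpa using hx.le
    · refine (ae_restrict_mem measurableSet_Ioi).mono fun a ha => ?_
      simpa using hb (-(a * I)) (by simp) (by simpa using (mem_Ioi.1 ha).le)
  -- Cauchy's theorem on the square [0, T] × [-T, 0]. The bottom and right sides have length T and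
  -- carry integrands bounded by C exp(-δT) and C exp(-εT), so they vanish in the limit.
  have rect : ∀ T : ℝ, 0 ≤ T → (∫ a in (0 : ℝ)..T, f a) = (∫ a in (0 : ℝ)..T, f (a - T * I)) +
      I * (∫ u in (0 : ℝ)..T, f (T - u * I)) - I * ∫ u in (0 : ℝ)..T, f (-(u * I)) := by
    intro T hT
    have h := Complex.integral_boundary_rect_eq_zero_of_continuousOn_of_differentiableOn f
      (-(T * I)) (T : ℂ) (hc.mono ?_) ?_
    · simp only [neg_re, mul_re, ofReal_re, I_re, mul_zero, ofReal_im, I_im, mul_one, sub_zero,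
        neg_zero, neg_im, mul_im, add_zero, ofReal_zero, zero_mul, zero_add, smul_eq_mul] at h
      have e1 : ∀ g : ℝ → ℂ, ∫ y in -T..0, g y = ∫ u in (0 : ℝ)..T, g (-u) := by
        intro g
        simp [intervalIntegral.integral_comp_neg]
      rw [e1, e1] at h
      simp only [ofReal_neg, neg_mul, ← sub_eq_add_neg] at h
      linear_combination -h
    · rintro z ⟨h1, h2⟩
      simp [uIcc_of_le hT, uIcc_of_le (neg_nonpos.2 hT)] at h1 h2
      exact ⟨h1.1, h2.2⟩
    · rintro z ⟨h1, h2⟩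
      simp [hT] at h1 h2
      exact (hd z h1.1 h2.2).differentiableWithinAt
  have lim1 : Tendsto (fun T : ℝ => ∫ a in (0 : ℝ)..T, f a) atTop (𝓝 (∫ a in Ioi (0 : ℝ), f a)) :=
    intervalIntegral_tendsto_integral_Ioi 0 int1 tendsto_id
  have lim2 : Tendsto (fun T : ℝ => ∫ u in (0 : ℝ)..T, f (-(u * I))) atTop
      (𝓝 (∫ u in Ioi (0 : ℝ), f (-(u * I)))) :=
    intervalIntegral_tendsto_integral_Ioi 0 int2 tendsto_id
  have lim0 : ∀ c : ℝ, 0 < c → Tendsto (fun T : ℝ => C * Real.exp (-c * T) * T) atTop (𝓝 0) := by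
    intro c hc0
    have h := Real.tendsto_pow_mul_exp_neg_atTop_nhds_zero 1
    have h2 := (h.comp (tendsto_id.const_mul_atTop hc0)).const_mul (C / c)
    rw [mul_zero] at h2
    refine h2.congr fun T => ?_
    simp
    field_simp
  have lim3 : Tendsto (fun T : ℝ => ∫ a in (0 : ℝ)..T, f (a - T * I)) atTop (𝓝 0) := by
    refine squeeze_zero_norm' ?_ (lim0 δ hδ)
    filter_upwards [eventually_ge_atTop 0] with T hT
    have := intervalIntegral.norm_integral_le_of_norm_le_const (a := 0) (b := T)
      (f := fun a : ℝ => f (a - T * I)) (C := C * Real.exp (-δ * T)) ?_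
    · simpa [abs_of_nonneg hT] using this
    · intro x hx
      rw [uIoc_of_le hT] at hx
      refine (hb _ (by simpa using hx.1.le) (by simpa using hT)).trans ?_
      gcongr
      simp
      nlinarith [hx.1]
  have lim4 : Tendsto (fun T : ℝ => ∫ u in (0 : ℝ)..T, f (T - u * I)) atTop (𝓝 0) := by
    refine squeeze_zero_norm' ?_ (lim0 ε hε)
    filter_upwards [eventually_ge_atTop 0] with T hT
    have := intervalIntegral.norm_integral_le_of_norm_le_const (a := 0) (b := T)
      (f := fun u : ℝ => f (T - u * I)) (C := C * Real.exp (-ε * T)) ?_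
    · simpa [abs_of_nonneg hT] using this
    · intro x hx
      rw [uIoc_of_le hT] at hx
      refine (hb _ (by simpa using hT) (by simpa using hx.1.le)).trans ?_
      gcongr
      simp
      nlinarith [hx.1]
  have lim5 := ((lim3.add (lim4.const_mul I)).sub (lim2.const_mul I))
  have := tendsto_nhds_unique lim1 (lim5.congr' ((eventually_ge_atTop 0).mono
    fun T hT => (rect T hT).symm))
  rw [this]; ring

/-! ### Thermal amplitudes -/

/-- A bounded function of the energy, holomorphic on the half-plane `Re w ≥ m`. -/
structure IsAmplitude (m : ℝ) (B : ℂ → ℂ) : Prop where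
  measurable : Measurable B
  differentiableAt : ∀ w : ℂ, m ≤ w.re → DifferentiableAt ℂ B w
  bounded : ∃ C : ℝ, 0 ≤ C ∧ ∀ w : ℂ, m ≤ w.re → ‖B w‖ ≤ C

/-- The Bose factor `1 / (1 - exp (-β w))` at complex energy. -/
def bose (β : ℝ) (w : ℂ) : ℂ := (1 - Complex.exp (-(w * β)))⁻¹

lemma norm_exp_neg_le {m β : ℝ} (hβ : 0 < β) {w : ℂ} (h : m ≤ w.re) :
    ‖Complex.exp (-(w * β))‖ ≤ Real.exp (-(m * β)) := by
  rw [Complex.norm_exp]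
  simp only [neg_re, mul_re, ofReal_re, ofReal_im, mul_zero, sub_zero]
  gcongr

lemma one_sub_exp_le {m β : ℝ} (hβ : 0 < β) {w : ℂ} (h : m ≤ w.re) :
    1 - Real.exp (-(m * β)) ≤ ‖1 - Complex.exp (-(w * β))‖ := by
  have := norm_sub_norm_le (1 : ℂ) (Complex.exp (-(w * β)))
  have h2 := norm_exp_neg_le hβ h
  simp at this
  linarith

/-- For Re w ≥ m > 0 one has |exp(-βw)| ≤ exp(-βm) < 1, which keeps the denominator away from zero.
-/
lemma isAmplitude_bose {m β : ℝ} (hm : 0 < m) (hβ : 0 < β) : IsAmplitude m (bose β) := by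
  have h0 : 0 < 1 - Real.exp (-(m * β)) := by
    have : Real.exp (-(m * β)) < 1 := by
      rw [Real.exp_lt_one_iff]
      nlinarith [mul_pos hm hβ]
    linarith
  refine ⟨by unfold bose; fun_prop, fun w h => ?_, (1 - Real.exp (-(m * β)))⁻¹, by positivity,
    fun w h => ?_⟩
  · unfold bose
    refine DifferentiableAt.inv (by fun_prop) ?_
    exact norm_pos_iff.1 (h0.trans_le (one_sub_exp_le hβ h))
  · unfold bose
    rw [norm_inv]
    exact inv_anti₀ h0 (one_sub_exp_le hβ h)

lemma isAmplitude_exp_mul_bose {m β : ℝ} (hm : 0 < m) (hβ : 0 < β) :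
    IsAmplitude m (fun w => Complex.exp (-(w * β)) * bose β w) := by
  obtain ⟨h1, h2, C, hC, h3⟩ := isAmplitude_bose hm hβ
  refine ⟨by fun_prop, fun w h => DifferentiableAt.mul (by fun_prop) (h2 w h),
    Real.exp (-(m * β)) * C, by positivity, fun w h => ?_⟩
  rw [norm_mul]
  exact mul_le_mul (norm_exp_neg_le hβ h) (h3 w h) (norm_nonneg _) (Real.exp_pos _).le

/-! ### The radial integral on the rotated contour -/

/-- The radial integrand, as a function of `ζ = w - m`, at time `τ` and directional
separation `s`, damped by `exp (-ε w)`. -/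
def radialFun (m : ℝ) (B : ℂ → ℂ) (ε τ s : ℝ) (ζ : ℂ) : ℂ :=
  1 / 2 * momentum m ζ * B (m + ζ) *
    Complex.exp (-(ε + τ * I) * (m + ζ) + I * momentum m ζ * s)

lemma norm_radialFun_le {m : ℝ} (hm : 0 < m) {B : ℂ → ℂ} {C : ℝ}
    (hB : ∀ w : ℂ, m ≤ w.re → ‖B w‖ ≤ C) {ε τ s : ℝ} {ζ : ℂ} (hε : 0 ≤ ε)
    (h1 : 0 ≤ ζ.re) (h2 : ζ.im ≤ 0) :
    ‖radialFun m B ε τ s ζ‖ ≤ ‖momentum m ζ‖ * C *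
      Real.exp (m * |s|) * Real.exp (-ε * ζ.re + (τ - |s|) * ζ.im) := by
  unfold radialFun
  rw [norm_mul, norm_mul, norm_mul, Complex.norm_exp, mul_assoc _ (Real.exp (m * |s|)),
    ← Real.exp_add]
  have hBζ := hB (m + ζ) (by simpa using h1)
  have hC : 0 ≤ C := (norm_nonneg _).trans hBζ
  have hs : -((momentum m ζ).im * s) ≤ (|ζ.im| + m) * |s| := by
    refine (neg_le_abs _).trans ?_
    rw [abs_mul]
    exact mul_le_mul_of_nonneg_right (abs_im_momentum_le hm h1) (abs_nonneg s)
  rw [abs_of_nonpos h2] at hs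
  refine mul_le_mul ?_ (Real.exp_le_exp.2 ?_) (Real.exp_pos _).le (by positivity)
  · refine mul_le_mul ?_ hBζ (norm_nonneg _) (norm_nonneg _)
    have := norm_nonneg (momentum m ζ)
    norm_num
    linarith
  · simp
    nlinarith

lemma continuousOn_radialFun {m : ℝ} (hm : 0 < m) {B : ℂ → ℂ} (hB : IsAmplitude m B)
    (ε τ s : ℝ) : ContinuousOn (radialFun m B ε τ s) {ζ | 0 ≤ ζ.re ∧ ζ.im ≤ 0} := by
  intro ζ hζ
  refine ContinuousAt.continuousWithinAt ?_
  have h1 := continuousAt_momentum hm hζ.1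
  have h2 : ContinuousAt (fun ζ => B (m + ζ)) ζ :=
    ContinuousAt.comp (f := fun ζ : ℂ => m + ζ)
      (hB.differentiableAt (m + ζ) (by simpa using hζ.1)).continuousAt (by fun_prop)
  exact ((continuousAt_const.mul h1).mul h2).mul (by fun_prop)

lemma differentiableAt_radialFun {m : ℝ} (hm : 0 < m) {B : ℂ → ℂ} (hB : IsAmplitude m B)
    (ε τ s : ℝ) {ζ : ℂ} (h1 : 0 < ζ.re) (h2 : ζ.im < 0) :
    DifferentiableAt ℂ (radialFun m B ε τ s) ζ := by
  have h3 := differentiableAt_momentum hm h1 h2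
  have h4 : DifferentiableAt ℂ (fun ζ => B (m + ζ)) ζ :=
    DifferentiableAt.comp (f := fun ζ : ℂ => m + ζ) ζ
      (hB.differentiableAt (m + ζ) (by simpa using h1.le)) (by fun_prop)
  exact (((differentiableAt_const _).mul h3).mul h4).mul (by fun_prop)

/-- Lets the linear growth of the momentum be paid for by part of the exponential decay. -/
lemma add_le_mul_exp {a b c x y : ℝ} (ha : 0 < a) (hb : 0 < b) (hc : 0 ≤ c) (hx : 0 ≤ x)
    (hy : 0 ≤ y) : x + y + c ≤ (1 / a + 1 / b + c) * Real.exp (a * x + b * y) := by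
  have h1 := Real.add_one_le_exp (a * x + b * y)
  have h2 : x + y + c ≤ (1 / a + 1 / b + c) * (a * x + b * y + 1) := by
    have : (1 / a + 1 / b + c) * (a * x + b * y + 1) =
      x + y + c + (1 / a) * (b * y) + 1 / a + (1 / b) * (a * x) + 1 / b + c * (a * x + b * y) := by
      field_simp; ring
    rw [this]
    have : 0 ≤ (1 / a) * (b * y) + 1 / a + (1 / b) * (a * x) + 1 / b + c * (a * x + b * y) := by
      positivity
    linarith
  exact h2.trans (mul_le_mul_of_nonneg_left h1 (by positivity))

/-- The radial integral with damping is the integral of the radial integrand along the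
vertical ray. -/
theorem integral_radial {m : ℝ} (hm : 0 < m) {B : ℂ → ℂ} (hB : IsAmplitude m B)
    {ε τ s : ℝ} (hε : 0 < ε) (hs : |s| < τ) :
    ∫ p in Ioi (0 : ℝ), (p ^ 2 : ℝ) • (B (Real.sqrt (p ^ 2 + m ^ 2) : ℝ) /
      (2 * (Real.sqrt (p ^ 2 + m ^ 2) : ℝ)) *
      Complex.exp (-(ε + τ * I) * (Real.sqrt (p ^ 2 + m ^ 2) : ℝ) + I * p * s)) =
    -I * ∫ u in Ioi (0 : ℝ), radialFun m B ε τ s (-(u * I)) := by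
  obtain ⟨C, hC, hBC⟩ := hB.bounded
  have hδ : 0 < τ - |s| := by linarith
  -- Half of each decay rate absorbs the momentum factor; the other half remains for the rotation.
  set K := (1 / (ε / 2) + 1 / ((τ - |s|) / 2) + 2 * m) * C * Real.exp (m * |s|)
  have hbound : ∀ ζ : ℂ, 0 ≤ ζ.re → ζ.im ≤ 0 → ‖radialFun m B ε τ s ζ‖ ≤
      K * Real.exp (-(ε / 2) * ζ.re + (τ - |s|) / 2 * ζ.im) := by
    intro ζ h1 h2
    refine (norm_radialFun_le hm hBC hε.le h1 h2).trans ?_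
    have h3 : ‖momentum m ζ‖ ≤ (1 / (ε / 2) + 1 / ((τ - |s|) / 2) + 2 * m) *
        Real.exp (ε / 2 * ζ.re + (τ - |s|) / 2 * (-ζ.im)) := by
      refine le_trans ?_ (add_le_mul_exp (half_pos hε) (half_pos hδ) (by positivity) h1
        (neg_nonneg.2 h2))
      have := Complex.norm_le_abs_re_add_abs_im ζ
      rw [abs_of_nonneg h1, abs_of_nonpos h2] at this
      linarith [norm_momentum_le hm h1]
    calc _ ≤ (1 / (ε / 2) + 1 / ((τ - |s|) / 2) + 2 * m) *
          Real.exp (ε / 2 * ζ.re + (τ - |s|) / 2 * (-ζ.im)) * C *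
          Real.exp (m * |s|) * Real.exp (-ε * ζ.re + (τ - |s|) * ζ.im) := by gcongr
      _ = K * (Real.exp (ε / 2 * ζ.re + (τ - |s|) / 2 * (-ζ.im)) *
          Real.exp (-ε * ζ.re + (τ - |s|) * ζ.im)) := by ring
      _ = _ := by rw [← Real.exp_add]; congr 2; ring
  rw [← integral_Ioi_eq_integral_vertical (continuousOn_radialFun hm hB ε τ s)
    (fun ζ h1 h2 => differentiableAt_radialFun hm hB ε τ s h1 h2) (half_pos hε) (half_pos hδ)
    hbound]
  have hcont : ContinuousOn (fun a : ℝ => radialFun m B ε τ s a) (Ici 0) :=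
    (continuousOn_radialFun hm hB ε τ s).comp (by fun_prop) (fun x hx => by simpa using hx)
  have hint : IntegrableOn (fun a : ℝ => radialFun m B ε τ s a) (Ici 0) := by
    rw [integrableOn_Ici_iff_integrableOn_Ioi]
    refine Integrable.mono' (g := fun a => K * Real.exp (-(ε / 2) * a))
      ((exp_neg_integrableOn_Ioi 0 (half_pos hε)).const_mul K)
      ((hcont.mono Ioi_subset_Ici_self).aestronglyMeasurable measurableSet_Ioi) ?_
    refine (ae_restrict_mem measurableSet_Ioi).mono fun a ha => ?_
    simpa using hbound a (by simpa using (mem_Ioi.1 ha).le) (by simp)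
  -- Substitution a = ω - m, with da = (p / ω) dp; it turns p² / (2ω) dp into (p / 2) da.
  set φ : ℝ → ℝ := fun p => Real.sqrt (p ^ 2 + m ^ 2) - m
  have hpos : ∀ p : ℝ, 0 < p ^ 2 + m ^ 2 := fun p => by positivity
  have hφ0 : φ 0 = 0 := by simp [φ, Real.sqrt_sq hm.le]
  have hφc : Continuous φ := by fun_prop
  have hφnn : ∀ p, 0 ≤ φ p := fun p => by
    have : m ≤ Real.sqrt (p ^ 2 + m ^ 2) := Real.le_sqrt_of_sq_le (by nlinarith)
    simp only [φ]; linarith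
  have hφd : ∀ p, HasDerivAt φ (p / Real.sqrt (p ^ 2 + m ^ 2)) p := by
    intro p
    have h := (((hasDerivAt_pow 2 p).add_const (m ^ 2)).sqrt (hpos p).ne').sub_const m
    have he : p / Real.sqrt (p ^ 2 + m ^ 2) =
        ((2 : ℕ) * p ^ (2 - 1)) / (2 * Real.sqrt (p ^ 2 + m ^ 2)) := by
      rw [← mul_div_mul_left _ _ (two_ne_zero (α := ℝ))]
      simp
    rw [he]
    exact h
  have hφt : Tendsto φ atTop atTop := by
    refine tendsto_atTop_mono (f := fun p => p - m) (fun p => ?_)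
      (tendsto_atTop_add_const_right _ _ tendsto_id)
    have : p ≤ Real.sqrt (p ^ 2 + m ^ 2) := Real.le_sqrt_of_sq_le (by nlinarith)
    simp only [φ]; linarith
  have key : ∀ p ∈ Ioi (0 : ℝ), (p ^ 2 : ℝ) • (B (Real.sqrt (p ^ 2 + m ^ 2) : ℝ) /
      (2 * (Real.sqrt (p ^ 2 + m ^ 2) : ℝ)) *
      Complex.exp (-(ε + τ * I) * (Real.sqrt (p ^ 2 + m ^ 2) : ℝ) + I * p * s)) =
      (p / Real.sqrt (p ^ 2 + m ^ 2)) •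
        ((fun a : ℝ => radialFun m B ε τ s a) ∘ φ) p := by
    intro p hp
    have hp : 0 < p := hp
    have hw : (m : ℂ) + (φ p : ℝ) = (Real.sqrt (p ^ 2 + m ^ 2) : ℝ) := by simp [φ]
    have hP : momentum m (φ p : ℝ) = (p : ℝ) := by
      rw [momentum_ofReal hm (hφnn p)]
      congr 1
      rw [Real.sqrt_eq_iff_mul_self_eq (by have := hφnn p; positivity) hp.le]
      have := Real.sq_sqrt (hpos p).le
      simp only [φ]
      linear_combination this
    have hne : ((Real.sqrt (p ^ 2 + m ^ 2) : ℝ) : ℂ) ≠ 0 := by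
      exact_mod_cast (Real.sqrt_pos.2 (hpos p)).ne'
    simp only [Function.comp_apply, radialFun, hw, hP, real_smul]
    push_cast
    field_simp
  rw [setIntegral_congr_fun measurableSet_Ioi key]
  have himg : φ '' Ici 0 ⊆ Ici 0 := by
    rintro _ ⟨p, -, rfl⟩; exact hφnn p
  rw [integral_deriv_smul_comp_Ioi (f := φ) (g := fun a : ℝ => radialFun m B ε τ s a)
    hφc.continuousOn hφt (fun p _ => (hφd p).hasDerivWithinAt)
    (hcont.mono ((image_mono Ioi_subset_Ici_self).trans himg)) (hint.mono_set himg) ?_, hφ0]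
  have := integrableOn_image_iff_integrableOn_abs_deriv_smul (s := Ici (0 : ℝ)) (f := φ)
    (f' := fun p => p / Real.sqrt (p ^ 2 + m ^ 2)) measurableSet_Ici
    (fun p _ => (hφd p).hasDerivWithinAt) ?_ (fun a : ℝ => radialFun m B ε τ s a)
  · refine (this.1 (hint.mono_set himg)).congr_fun ?_ measurableSet_Ici
    intro p hp
    have : 0 ≤ p / Real.sqrt (p ^ 2 + m ^ 2) := div_nonneg hp (Real.sqrt_nonneg _)
    simp [abs_of_nonneg this]
  · intro p hp q hq h
    simp only [φ, sub_left_inj] at h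
    rw [Real.sqrt_inj (hpos p).le (hpos q).le] at h
    exact (sq_eq_sq₀ hp hq).1 (by linarith)

/-! ### Polar coordinates -/

/-- The product of the surface measure of the unit sphere with Lebesgue measure on `(0, ∞)`. -/
def rayMeasure : Measure (Metric.sphere (0 : Space) 1 × ℝ) :=
  (volume : Measure Space).toSphere.prod (volume.restrict (Ioi 0))

/-- Integration over momentum space in polar coordinates. -/
theorem integral_polar {g : Space → ℂ} (hg : Integrable g) :
    ∫ k, g k = ∫ n, (∫ p in Ioi (0 : ℝ), (p ^ 2 : ℝ) • g (p • (n : Space)))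
      ∂(volume : Measure Space).toSphere := by
  have hmp := (volume : Measure Space).measurePreserving_homeomorphUnitSphereProd
  have hemb := (homeomorphUnitSphereProd Space).measurableEmbedding
  have hd : Module.finrank ℝ Space - 1 = 2 := by simp
  set G : Metric.sphere (0 : Space) 1 × Ioi (0 : ℝ) → ℂ := fun q => g (q.2.1 • q.1.1)
  have hG : ∀ x : ({0}ᶜ : Set Space), G (homeomorphUnitSphereProd Space x) = g x := by
    intro x
    simp only [G]
    congr 1
    have := homeomorphUnitSphereProd_symm_apply_coe Space (homeomorphUnitSphereProd Space x)
    rw [Homeomorph.symm_apply_apply] at this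
    exact this.symm
  have h1 : ∫ k, g k = ∫ x : ({0}ᶜ : Set Space), g (x : Space)
      ∂((volume : Measure Space).comap (↑)) := by
    rw [integral_subtype_comap (measurableSet_singleton _).compl g,
      restrict_compl_singleton]
  have hint : Integrable G ((volume : Measure Space).toSphere.prod
      (Measure.volumeIoiPow (Module.finrank ℝ Space - 1))) := by
    rw [← hmp.integrable_comp_emb hemb]
    have : G ∘ homeomorphUnitSphereProd Space = g ∘ ((↑) : ({0}ᶜ : Set Space) → Space) :=
      funext hG
    rw [this, ← integrableOn_iff_comap_subtypeVal (measurableSet_singleton _).compl]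
    exact hg.integrableOn
  rw [h1]
  simp_rw [← hG]
  rw [hmp.integral_comp hemb G, integral_prod _ hint]
  congr 1
  ext n
  rw [hd]
  simp only [Measure.volumeIoiPow, ENNReal.ofReal]
  rw [integral_withDensity_eq_integral_smul ((measurable_subtype_coe.pow_const _).real_toNNReal),
    integral_subtype_comap measurableSet_Ioi
      fun a => Real.toNNReal (a ^ 2) • g (a • n.1)]
  refine setIntegral_congr_fun measurableSet_Ioi fun x hx => ?_
  rw [NNReal.smul_def, Real.coe_toNNReal _ (by positivity)]

/-! ### Differentiating superpositions of exponentials -/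

section ExpIntegral

variable {Λ V E : Type} [MeasurableSpace Λ] {μ : Measure Λ}
  [NormedAddCommGroup V] [NormedSpace ℝ V]
  [NormedAddCommGroup E] [NormedSpace ℂ E]

lemma aestronglyMeasurable_exp_smul {L : Λ → V →L[ℝ] ℂ} {A : Λ → E}
    (hL : AEStronglyMeasurable L μ) (hA : AEStronglyMeasurable A μ) (v : V) :
    AEStronglyMeasurable (fun l => Complex.exp (L l v) • A l) μ := by
  refine AEStronglyMeasurable.smul ?_ hA
  exact (Continuous.comp_aestronglyMeasurable
    (g := fun l : V →L[ℝ] ℂ => Complex.exp (l v)) (by fun_prop) hL)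

/-- Local domination of a superposition of exponentials together with all its derivatives. -/
structure IsTame (μ : Measure Λ) (U : Set V) (L : Λ → V →L[ℝ] ℂ) (A : Λ → E) : Prop where
  measurable_form : AEStronglyMeasurable L μ
  measurable_amplitude : AEStronglyMeasurable A μ
  dominated : ∀ N : ℕ, ∀ v ∈ U, ∃ s ∈ 𝓝 v, ∃ g : Λ → ℝ, Integrable g μ ∧
    ∀ᵐ l ∂μ, ∀ v' ∈ s, ‖A l‖ * (1 + ‖L l‖) ^ N * Real.exp (L l v').re ≤ g l

lemma IsTame.integrable {U : Set V} {L : Λ → V →L[ℝ] ℂ} {A : Λ → E} (h : IsTame μ U L A)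
    {v : V} (hv : v ∈ U) : Integrable (fun l => Complex.exp (L l v) • A l) μ := by
  obtain ⟨s, hs, g, hg, hb⟩ := h.dominated 0 v hv
  refine hg.mono' (aestronglyMeasurable_exp_smul h.measurable_form h.measurable_amplitude v) ?_
  filter_upwards [hb] with l hl
  have := hl v (mem_of_mem_nhds hs)
  rw [norm_smul, Complex.norm_exp]
  simpa [mul_comm] using this

variable [NormedSpace ℝ E] [IsScalarTower ℝ ℂ E]

/-- A superposition of exponentials of real-linear forms. -/
def expIntegral (μ : Measure Λ) (L : Λ → V →L[ℝ] ℂ) (A : Λ → E) (v : V) : E :=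
  ∫ l, Complex.exp (L l v) • A l ∂μ

/-- The linear map `v ↦ l v • a`. -/
def formSmul (l : V →L[ℝ] ℂ) (a : E) : V →L[ℝ] E :=
  ((ContinuousLinearMap.lsmul ℝ ℂ).flip a).comp l

lemma formSmul_apply (l : V →L[ℝ] ℂ) (a : E) (v : V) : formSmul l a v = l v • a := rfl

lemma norm_formSmul_le (l : V →L[ℝ] ℂ) (a : E) : ‖formSmul l a‖ ≤ ‖l‖ * ‖a‖ := by
  refine ContinuousLinearMap.opNorm_le_bound _ (by positivity) fun v => ?_
  rw [formSmul_apply, norm_smul]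
  nlinarith [l.le_opNorm v, norm_nonneg a]

/-- Differentiating exp(L v) A replaces A by L ⊗ A, which costs one power of 1 + ‖L‖. Domination for
all powers N is therefore stable under differentiation. -/
lemma IsTame.formSmul {U : Set V} {L : Λ → V →L[ℝ] ℂ} {A : Λ → E} (h : IsTame μ U L A) :
    IsTame μ U L (fun l => formSmul (L l) (A l)) := by
  refine ⟨h.measurable_form, ?_, fun N v hv => ?_⟩
  · have hc : Continuous fun p : (V →L[ℝ] ℂ) × E => ThermalField.formSmul p.1 p.2 := by
      unfold ThermalField.formSmul
      fun_prop
    exact hc.comp_aestronglyMeasurable (h.measurable_form.prodMk h.measurable_amplitude)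
  · obtain ⟨s, hs, g, hg, hb⟩ := h.dominated (N + 1) v hv
    refine ⟨s, hs, g, hg, ?_⟩
    filter_upwards [hb] with l hl v' hv'
    refine le_trans ?_ (hl v' hv')
    refine mul_le_mul_of_nonneg_right ?_ (Real.exp_pos _).le
    rw [pow_succ', ← mul_assoc]
    refine mul_le_mul_of_nonneg_right ?_ (by positivity)
    nlinarith [norm_formSmul_le (L l) (A l), norm_nonneg (A l)]

lemma IsTame.hasFDerivAt {U : Set V} {L : Λ → V →L[ℝ] ℂ} {A : Λ → E} (h : IsTame μ U L A)
    {v : V} (hv : v ∈ U) :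
    HasFDerivAt (expIntegral μ L A) (expIntegral μ L (fun l => ThermalField.formSmul (L l) (A l)) v)
      v := by
  obtain ⟨s, hs, g, hg, hb⟩ := h.formSmul.dominated 0 v hv
  refine hasFDerivAt_integral_of_dominated_of_fderiv_le (𝕜 := ℝ) (s := s) (bound := g)
    (F := fun v l => Complex.exp (L l v) • A l)
    (F' := fun v l => Complex.exp (L l v) • ThermalField.formSmul (L l) (A l)) hs
    (Eventually.of_forall fun v' =>
      aestronglyMeasurable_exp_smul h.measurable_form h.measurable_amplitude v')
    (h.integrable hv)
    (aestronglyMeasurable_exp_smul h.measurable_form h.formSmul.measurable_amplitude v) ?_ hg ?_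
  · filter_upwards [hb] with l hl v' hv'
    rw [norm_smul, Complex.norm_exp]
    simpa [mul_comm] using hl v' hv'
  · refine Eventually.of_forall fun l v' _ => ?_
    have h1 := ((L l).hasFDerivAt (x := v')).cexp.smul_const (A l)
    refine h1.congr_fderiv ?_
    ext x
    simp [formSmul_apply, mul_smul]

/-- The value space is quantified inside the induction because each derivative takes values in a new
space of linear maps. -/
lemma IsTame.contDiffOn_nat {Λ V : Type} [MeasurableSpace Λ] {μ : Measure Λ}
    [NormedAddCommGroup V] [NormedSpace ℝ V]
    {U : Set V} (hU : IsOpen U) {L : Λ → V →L[ℝ] ℂ} (n : ℕ) :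
    ∀ (E : Type) [NormedAddCommGroup E] [NormedSpace ℝ E] [NormedSpace ℂ E] [IsScalarTower ℝ ℂ E]
      (A : Λ → E), IsTame μ U L A → ContDiffOn ℝ n (expIntegral μ L A) U := by
  induction n with
  | zero =>
    intro E _ _ _ _ A h
    rw [Nat.cast_zero, contDiffOn_zero]
    exact fun v hv => (h.hasFDerivAt hv).continuousAt.continuousWithinAt
  | succ n ih =>
    intro E _ _ _ _ A h
    rw [Nat.cast_add_one, contDiffOn_succ_iff_fderiv_of_isOpen hU]
    refine ⟨fun v hv => (h.hasFDerivAt hv).differentiableAt.differentiableWithinAt, by simp, ?_⟩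
    exact (ih _ _ h.formSmul).congr fun v hv => (h.hasFDerivAt hv).fderiv

lemma IsTame.contDiffOn {U : Set V} (hU : IsOpen U) {L : Λ → V →L[ℝ] ℂ} {A : Λ → E}
    (h : IsTame μ U L A) : ContDiffOn ℝ ∞ (expIntegral μ L A) U :=
  contDiffOn_infty.2 fun n => IsTame.contDiffOn_nat hU n E A h

lemma IsTame.fderiv_apply {U : Set V} {L : Λ → V →L[ℝ] ℂ} {A : Λ → ℂ} (h : IsTame μ U L A)
    {v : V} (hv : v ∈ U) (d : V) :
    fderiv ℝ (expIntegral μ L A) v d = expIntegral μ L (fun l => L l d * A l) v := by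
  rw [(h.hasFDerivAt hv).fderiv]
  unfold expIntegral
  rw [ContinuousLinearMap.integral_apply (h.formSmul.integrable hv)]
  rfl

end ExpIntegral

/-! ### Ray exponents and their bounds -/

/-- Difference of the time coordinates. -/
def timeDiff : Spacetime × Spacetime →L[ℝ] ℝ :=
  (ContinuousLinearMap.fst ℝ ℝ Space).comp
    (ContinuousLinearMap.snd ℝ Spacetime Spacetime - ContinuousLinearMap.fst ℝ Spacetime Spacetime)

/-- Difference of the space coordinates. -/
def spaceDiff : Spacetime × Spacetime →L[ℝ] Space :=
  (ContinuousLinearMap.snd ℝ ℝ Space).comp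
    (ContinuousLinearMap.snd ℝ Spacetime Spacetime - ContinuousLinearMap.fst ℝ Spacetime Spacetime)

lemma timeDiff_apply (z : Spacetime × Spacetime) : timeDiff z = z.2.1 - z.1.1 := rfl

lemma spaceDiff_apply (z : Spacetime × Spacetime) : spaceDiff z = z.2.2 - z.1.2 := rfl

lemma mem_futurePairs_iff (z : Spacetime × Spacetime) :
    z ∈ futurePairs ↔ ‖spaceDiff z‖ < timeDiff z := by
  have h : minkowskiSq (z.2 - z.1) = -(timeDiff z) ^ 2 + ‖spaceDiff z‖ ^ 2 := by
    rw [EuclideanSpace.real_norm_sq_eq]; rfl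
  have h2 : (z.2 - z.1).1 = timeDiff z := rfl
  simp only [futurePairs, FutureTimelike, mem_ofPred_eq, h, h2]
  constructor
  · rintro ⟨h3, h4⟩
    exact lt_of_pow_lt_pow_left₀ 2 h4.le (by linarith)
  · intro h3
    have := norm_nonneg (spaceDiff z)
    exact ⟨by nlinarith, by linarith⟩

lemma isOpen_futurePairs : IsOpen futurePairs := by
  have : futurePairs = {z | ‖spaceDiff z‖ < timeDiff z} := by
    ext z; exact mem_futurePairs_iff z
  rw [this]
  exact isOpen_lt (by fun_prop) (by fun_prop)

/-- The exponent of the mode with direction `n` and energy `m - iu`. -/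
def rayForm (m : ℝ) (l : Metric.sphere (0 : Space) 1 × ℝ) : Spacetime × Spacetime →L[ℝ] ℂ :=
  (-(I * (m - l.2 * I))) • Complex.ofRealCLM.comp timeDiff +
    (I * momentum m (-(l.2 * I))) •
      Complex.ofRealCLM.comp ((innerSL ℝ (l.1 : Space)).comp spaceDiff)

lemma rayForm_apply (m : ℝ) (l : Metric.sphere (0 : Space) 1 × ℝ) (z : Spacetime × Spacetime) :
    rayForm m l z = -(I * (m - l.2 * I)) * timeDiff z +
      I * momentum m (-(l.2 * I)) * (inner ℝ (l.1 : Space) (spaceDiff z) : ℝ) := rfl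

lemma stronglyMeasurable_rayForm (m : ℝ) : StronglyMeasurable (rayForm m) := by
  unfold rayForm
  have h1 : Measurable fun l : Metric.sphere (0 : Space) 1 × ℝ =>
      I * momentum m (-(l.2 * I)) :=
    measurable_const.mul ((measurable_momentum m).comp (by fun_prop))
  refine StronglyMeasurable.add (Continuous.stronglyMeasurable (by fun_prop)) ?_
  exact h1.stronglyMeasurable.smul (Continuous.stronglyMeasurable (by fun_prop))

/-- The decay rate in u is the timelike gap, time difference minus spatial distance; the bounded
excess of |Im p| over u contributes only m times the distance. -/
lemma rayForm_re_le {m : ℝ} (hm : 0 < m) {l : Metric.sphere (0 : Space) 1 × ℝ} (hl : 0 < l.2)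
    (z : Spacetime × Spacetime) :
    (rayForm m l z).re ≤ -(timeDiff z - ‖spaceDiff z‖) * l.2 + m * ‖spaceDiff z‖ := by
  rw [rayForm_apply]
  have h1 := abs_im_momentum_le hm (ζ := -(l.2 * I)) (by simp)
  have h2 : |inner ℝ (l.1 : Space) (spaceDiff z)| ≤ ‖spaceDiff z‖ := by
    simpa using abs_real_inner_le_norm (l.1 : Space) (spaceDiff z)
  simp [abs_of_pos hl] at h1
  have h3 : -((momentum m (-(l.2 * I))).im * inner ℝ (l.1 : Space) (spaceDiff z)) ≤
      (l.2 + m) * ‖spaceDiff z‖ := by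
    refine (neg_le_abs _).trans ?_
    rw [abs_mul]
    exact mul_le_mul h1 h2 (abs_nonneg _) (by positivity)
  simp
  nlinarith

lemma exists_norm_rayForm_le {m : ℝ} (hm : 0 < m) : ∃ K : ℝ, 0 ≤ K ∧
    ∀ l : Metric.sphere (0 : Space) 1 × ℝ, 0 < l.2 → ‖rayForm m l‖ ≤ K * (1 + l.2) := by
  refine ⟨(m + 1) * ‖timeDiff‖ + (2 * m + 1) * ‖spaceDiff‖, by positivity, fun l hl => ?_⟩
  refine ContinuousLinearMap.opNorm_le_bound _ (by positivity) fun z => ?_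
  rw [rayForm_apply]
  have h1 := norm_momentum_le hm (ζ := -(l.2 * I)) (by simp)
  simp [abs_of_pos hl] at h1
  have h2 : ‖((inner ℝ (l.1 : Space) (spaceDiff z) : ℝ) : ℂ)‖ ≤ ‖spaceDiff‖ * ‖z‖ := by
    rw [Complex.norm_real]
    refine le_trans ?_ (spaceDiff.le_opNorm z)
    simpa using abs_real_inner_le_norm (l.1 : Space) (spaceDiff z)
  have h3 : ‖((timeDiff z : ℝ) : ℂ)‖ ≤ ‖timeDiff‖ * ‖z‖ := by
    rw [Complex.norm_real]; exact timeDiff.le_opNorm z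
  have h4 : ‖-(I * ((m : ℂ) - l.2 * I))‖ ≤ m + l.2 := by
    rw [norm_neg, norm_mul]
    have := norm_sub_le (m : ℂ) (l.2 * I)
    simpa [abs_of_pos hl, abs_of_pos hm] using this
  calc _ ≤ ‖-(I * ((m : ℂ) - l.2 * I))‖ * ‖((timeDiff z : ℝ) : ℂ)‖ +
        ‖I * momentum m (-(l.2 * I))‖ * ‖((inner ℝ (l.1 : Space) (spaceDiff z) : ℝ) : ℂ)‖ := by
        rw [← norm_mul, ← norm_mul]; exact norm_add_le _ _
    _ ≤ (m + l.2) * (‖timeDiff‖ * ‖z‖) + (l.2 + 2 * m) * (‖spaceDiff‖ * ‖z‖) := by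
        gcongr
        simpa using h1
    _ ≤ ((m + 1) * (1 + l.2)) * (‖timeDiff‖ * ‖z‖) +
        ((2 * m + 1) * (1 + l.2)) * (‖spaceDiff‖ * ‖z‖) := by
        gcongr <;> nlinarith
    _ = _ := by ring

/-- An amplitude on the rays of order `√u` at the threshold and of polynomial growth. -/
def IsRayAmplitude (A : Metric.sphere (0 : Space) 1 × ℝ → ℂ) : Prop :=
  AEStronglyMeasurable A rayMeasure ∧ ∃ (C : ℝ) (N : ℕ), 0 ≤ C ∧
    ∀ l, 0 < l.2 → ‖A l‖ ≤ C * Real.sqrt l.2 * (1 + l.2) ^ N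

/-- Each derivative adds one power of 1 + u and keeps the factor √u, so the decay rate is
unaffected. -/
lemma IsRayAmplitude.form_mul {m : ℝ} (hm : 0 < m) {A : Metric.sphere (0 : Space) 1 × ℝ → ℂ}
    (hA : IsRayAmplitude A) (d : Spacetime × Spacetime) :
    IsRayAmplitude (fun l => rayForm m l d * A l) := by
  obtain ⟨h1, C, N, hC, h2⟩ := hA
  obtain ⟨K, hK, h3⟩ := exists_norm_rayForm_le hm
  refine ⟨AEStronglyMeasurable.mul ?_ h1, K * ‖d‖ * C, N + 1, by positivity, fun l hl => ?_⟩
  · exact (Continuous.comp_stronglyMeasurable (g := fun l : Spacetime × Spacetime →L[ℝ] ℂ => l d)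
      (by fun_prop) (stronglyMeasurable_rayForm m)).aestronglyMeasurable
  · rw [norm_mul]
    calc _ ≤ (K * (1 + l.2) * ‖d‖) * (C * Real.sqrt l.2 * (1 + l.2) ^ N) := by
          gcongr
          · exact ((rayForm m l).le_opNorm d).trans (by gcongr; exact h3 l hl)
          · exact h2 l hl
      _ = _ := by ring

lemma exists_pow_le_exp (N : ℕ) {c : ℝ} (hc : 0 < c) :
    ∃ C : ℝ, 0 ≤ C ∧ ∀ u : ℝ, 0 ≤ u → (1 + u) ^ N ≤ C * Real.exp (c * u) := by
  refine ⟨N.factorial / c ^ N * Real.exp c, by positivity, fun u hu => ?_⟩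
  have h := Real.pow_div_factorial_le_exp (c * (1 + u)) (by positivity) N
  rw [div_le_iff₀ (by positivity), mul_pow] at h
  have h2 : Real.exp (c * (1 + u)) = Real.exp c * Real.exp (c * u) := by
    rw [← Real.exp_add]; ring_nf
  rw [h2] at h
  rw [div_mul_eq_mul_div, div_mul_eq_mul_div, le_div_iff₀ (by positivity)]
  linarith

lemma sqrt_mul_exp_eq_rpow (c u : ℝ) :
    Real.sqrt u * Real.exp (-(c * u)) = u ^ ((3 / 2 : ℝ) - 1) * Real.exp (-(c * u)) := by
  rw [Real.sqrt_eq_rpow]; norm_num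

lemma integrableOn_sqrt_mul_exp {c : ℝ} (hc : 0 < c) :
    IntegrableOn (fun u => Real.sqrt u * Real.exp (-(c * u))) (Ioi 0) := by
  have := integrableOn_rpow_mul_exp_neg_mul_rpow (p := 1) (s := (3 / 2 : ℝ) - 1) (b := c)
    (by norm_num) one_pos hc
  refine this.congr_fun (fun u _ => ?_) measurableSet_Ioi
  simp only [Real.rpow_one, neg_mul]
  rw [sqrt_mul_exp_eq_rpow]

lemma integral_sqrt_mul_exp {c : ℝ} (hc : 0 < c) :
    ∫ u in Ioi (0 : ℝ), Real.sqrt u * Real.exp (-(c * u)) =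
      Real.Gamma (3 / 2) / c ^ (3 / 2 : ℝ) := by
  simp_rw [sqrt_mul_exp_eq_rpow]
  rw [Real.integral_rpow_mul_exp_neg_mul_Ioi (by norm_num) hc, Real.div_rpow zero_le_one hc.le]
  simp [div_eq_mul_inv, mul_comm]

instance : SFinite rayMeasure := by unfold rayMeasure; infer_instance

lemma ae_rayMeasure : ∀ᵐ l ∂rayMeasure, 0 < l.2 := by
  unfold rayMeasure
  exact Measure.quasiMeasurePreserving_snd.ae (ae_restrict_mem measurableSet_Ioi)

lemma integrable_rayMeasure_snd {g : ℝ → ℝ} (hg : IntegrableOn g (Ioi 0)) :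
    Integrable (fun l => g l.2) rayMeasure :=
  Integrable.comp_snd hg _

lemma integral_rayMeasure_snd (g : ℝ → ℝ) : ∫ l, g l.2 ∂rayMeasure =
    (volume : Measure Space).toSphere.real univ * ∫ u in Ioi (0 : ℝ), g u := by
  unfold rayMeasure
  rw [integral_fun_snd (μ := (volume : Measure Space).toSphere) (f := g)]
  rfl

/-- A gap of size δ + t is split: δ absorbs all polynomial growth, and exp(-tu) survives. Fixed t
gives dominating functions, while t equal to the time translation gives decay. -/
lemma IsRayAmplitude.norm_mul_exp_le {m : ℝ} (hm : 0 < m) {K : ℝ} (hK : 0 ≤ K)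
    (hL : ∀ l : Metric.sphere (0 : Space) 1 × ℝ, 0 < l.2 → ‖rayForm m l‖ ≤ K * (1 + l.2))
    {A : Metric.sphere (0 : Space) 1 × ℝ → ℂ} (hA : IsRayAmplitude A) (N : ℕ)
    {δ : ℝ} (hδ : 0 < δ) (R : ℝ) : ∃ C : ℝ, 0 ≤ C ∧ ∀ l, 0 < l.2 → ∀ z : Spacetime × Spacetime,
      ∀ t : ℝ, δ + t ≤ timeDiff z - ‖spaceDiff z‖ → ‖spaceDiff z‖ ≤ R →
      ‖A l‖ * (1 + ‖rayForm m l‖) ^ N * Real.exp (rayForm m l z).re ≤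
        C * (Real.sqrt l.2 * Real.exp (-(t * l.2))) := by
  obtain ⟨h1, C, M, hC, h2⟩ := hA
  obtain ⟨D, hD, h3⟩ := exists_pow_le_exp (M + N) hδ
  refine ⟨C * (1 + K) ^ N * D * Real.exp (m * R), by positivity, fun l hl z t hz hR => ?_⟩
  have e1 : 1 + ‖rayForm m l‖ ≤ (1 + K) * (1 + l.2) := by nlinarith [hL l hl]
  have e2 : (rayForm m l z).re ≤ -(δ * l.2) + -(t * l.2) + m * R := by
    refine (rayForm_re_le hm hl z).trans ?_
    nlinarith
  calc _ ≤ (C * Real.sqrt l.2 * (1 + l.2) ^ M) * ((1 + K) * (1 + l.2)) ^ N *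
        Real.exp (-(δ * l.2) + -(t * l.2) + m * R) := by
        gcongr
        exact h2 l hl
    _ = C * (1 + K) ^ N * (1 + l.2) ^ (M + N) * Real.exp (-(δ * l.2)) * Real.exp (m * R) *
        (Real.sqrt l.2 * Real.exp (-(t * l.2))) := by
        rw [Real.exp_add, Real.exp_add, mul_pow, pow_add]; ring
    _ ≤ C * (1 + K) ^ N * (D * Real.exp (δ * l.2)) * Real.exp (-(δ * l.2)) * Real.exp (m * R) *
        (Real.sqrt l.2 * Real.exp (-(t * l.2))) := by
        gcongr
        exact h3 _ hl.le
    _ = C * (1 + K) ^ N * D * (Real.exp (δ * l.2) * Real.exp (-(δ * l.2))) * Real.exp (m * R) *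
        (Real.sqrt l.2 * Real.exp (-(t * l.2))) := by ring
    _ = _ := by rw [← Real.exp_add]; simp

lemma IsRayAmplitude.isTame {m : ℝ} (hm : 0 < m) {A : Metric.sphere (0 : Space) 1 × ℝ → ℂ}
    (hA : IsRayAmplitude A) : IsTame rayMeasure futurePairs (rayForm m) A := by
  refine ⟨(stronglyMeasurable_rayForm m).aestronglyMeasurable, hA.1, fun N v hv => ?_⟩
  rw [mem_futurePairs_iff] at hv
  obtain ⟨K, hK, hL⟩ := exists_norm_rayForm_le hm
  -- Near v two thirds of the gap persist: one third for the polynomial factors, one for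
  -- integrability.
  set δ := (timeDiff v - ‖spaceDiff v‖) / 3
  have hδ : 0 < δ := by simp only [δ]; linarith
  obtain ⟨C, hC, h⟩ := hA.norm_mul_exp_le hm hK hL N hδ (‖spaceDiff v‖ + 1)
  refine ⟨{z | δ + δ < timeDiff z - ‖spaceDiff z‖ ∧ ‖spaceDiff z‖ < ‖spaceDiff v‖ + 1}, ?_,
    fun l => C * (Real.sqrt l.2 * Real.exp (-(δ * l.2))),
    (integrable_rayMeasure_snd (integrableOn_sqrt_mul_exp hδ)).const_mul C, ?_⟩
  · have h1 : ContinuousAt (fun z => timeDiff z - ‖spaceDiff z‖) v := by fun_prop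
    have h2 : ContinuousAt (fun z => ‖spaceDiff z‖) v := by fun_prop
    exact (h1.eventually_const_lt (by simp only [δ]; linarith)).and
      (h2.eventually_lt_const (by linarith))
  · filter_upwards [ae_rayMeasure] with l hl z hz
    exact h l hl z δ hz.1.le hz.2.le

lemma exists_gap {K : Set (Spacetime × Spacetime)} (hK : IsCompact K) (hKU : K ⊆ futurePairs) :
    ∃ δ R : ℝ, 0 < δ ∧ ∀ z ∈ K, δ ≤ timeDiff z - ‖spaceDiff z‖ ∧ ‖spaceDiff z‖ ≤ R := by
  rcases K.eq_empty_or_nonempty with rfl | hne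
  · exact ⟨1, 0, one_pos, by simp⟩
  · obtain ⟨z, hz, h1⟩ := hK.exists_isMinOn hne
      (f := fun z => timeDiff z - ‖spaceDiff z‖) (by fun_prop)
    obtain ⟨z', hz', h2⟩ := hK.exists_isMaxOn hne (f := fun z => ‖spaceDiff z‖) (by fun_prop)
    have := (mem_futurePairs_iff z).1 (hKU hz)
    exact ⟨_, _, sub_pos.2 this, fun y hy => ⟨h1 hy, h2 hy⟩⟩

/-- Superpositions of ray exponentials decay like `t ^ (-3/2)` under time translation. -/
theorem IsRayAmplitude.decay {m : ℝ} (hm : 0 < m) {A : Metric.sphere (0 : Space) 1 × ℝ → ℂ}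
    (hA : IsRayAmplitude A) {K : Set (Spacetime × Spacetime)} (hK : IsCompact K)
    (hKU : K ⊆ futurePairs) : ∃ C : ℝ, 0 ≤ C ∧ ∀ x y : Spacetime, (x, y) ∈ K → ∀ t : ℝ, 0 < t →
      ‖expIntegral rayMeasure (rayForm m) A (x, (y.1 + t, y.2))‖ ≤ C / t ^ (3 / 2 : ℝ) := by
  obtain ⟨δ, R, hδ, hz⟩ := exists_gap hK hKU
  obtain ⟨B, hB, hL⟩ := exists_norm_rayForm_le hm
  obtain ⟨C, hC, h⟩ := hA.norm_mul_exp_le hm hB hL 0 hδ R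
  refine ⟨C * ((volume : Measure Space).toSphere.real univ * Real.Gamma (3 / 2)),
    mul_nonneg hC (mul_nonneg measureReal_nonneg (Real.Gamma_pos_of_pos (by norm_num)).le),
    fun x y hxy t ht => ?_⟩
  unfold expIntegral
  refine (norm_integral_le_of_norm_le
    ((integrable_rayMeasure_snd (integrableOn_sqrt_mul_exp ht)).const_mul C) ?_).trans ?_
  · filter_upwards [ae_rayMeasure] with l hl
    rw [norm_smul, Complex.norm_exp, mul_comm]
    obtain ⟨h1, h2⟩ := hz _ hxy
    -- The translation enlarges the gap by exactly t and leaves the spatial separation alone.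
    have := h l hl (x, (y.1 + t, y.2)) t (by
      simp only [timeDiff_apply, spaceDiff_apply] at h1 ⊢; linarith) h2
    simpa using this
  · rw [integral_const_mul, integral_rayMeasure_snd (fun u => Real.sqrt u * Real.exp (-(t * u))),
      integral_sqrt_mul_exp ht]
    apply le_of_eq; ring

lemma add_time_mem_futurePairs {x y : Spacetime} (h : (x, y) ∈ futurePairs) {t : ℝ} (ht : 0 ≤ t) :
    (x, (y.1 + t, y.2)) ∈ futurePairs := by
  rw [mem_futurePairs_iff] at *
  simp only [timeDiff_apply, spaceDiff_apply] at *
  linarith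

/-! ### Derivatives and decay of ray superpositions -/

/-- On `futurePairs`, the function is a sum of a superposition of ray exponentials and
the conjugate of another. -/
def IsRaySuperposition (m : ℝ) (g : Spacetime × Spacetime → ℂ) : Prop :=
  ∃ A₁ A₂, IsRayAmplitude A₁ ∧ IsRayAmplitude A₂ ∧ EqOn g (fun v =>
    expIntegral rayMeasure (rayForm m) A₁ v +
      (starRingEnd ℂ) (expIntegral rayMeasure (rayForm m) A₂ v)) futurePairs

lemma IsRaySuperposition.contDiffOn {m : ℝ} (hm : 0 < m) {g : Spacetime × Spacetime → ℂ}
    (hg : IsRaySuperposition m g) : ContDiffOn ℝ ∞ g futurePairs := by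
  obtain ⟨A₁, A₂, h1, h2, h3⟩ := hg
  refine ContDiffOn.congr ?_ h3
  exact ((h1.isTame hm).contDiffOn isOpen_futurePairs).add
    (Complex.conjCLE.contDiff.comp_contDiffOn ((h2.isTame hm).contDiffOn isOpen_futurePairs))

/-- Conjugation is real-linear, so it commutes with real partial derivatives and the class is closed
under them. -/
lemma IsRaySuperposition.partialD {m : ℝ} (hm : 0 < m) {g : Spacetime × Spacetime → ℂ}
    (hg : IsRaySuperposition m g) (i : Fin 8) : IsRaySuperposition m (partialD i g) := by
  obtain ⟨A₁, A₂, h1, h2, h3⟩ := hg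
  refine ⟨_, _, h1.form_mul hm (direction i), h2.form_mul hm (direction i), fun v hv => ?_⟩
  have h4 := (h3.eventuallyEq_of_mem (isOpen_futurePairs.mem_nhds hv)).fderiv_eq (𝕜 := ℝ)
  have d1 := ((h1.isTame hm).hasFDerivAt hv).differentiableAt
  have d2 := ((h2.isTame hm).hasFDerivAt hv)
  have h5 := d1.hasFDerivAt.add
    ((Complex.conjCLE.toContinuousLinearMap.hasFDerivAt).comp v d2.differentiableAt.hasFDerivAt)
  have h6 := h5.fderiv
  simp only [ThermalField.partialD]
  rw [h4]
  refine (congrArg (fun T => T (direction i)) h6).trans ?_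
  rw [add_apply, ContinuousLinearMap.comp_apply,
    (h1.isTame hm).fderiv_apply hv, (h2.isTame hm).fderiv_apply hv]
  rfl

lemma IsRaySuperposition.multiD {m : ℝ} (hm : 0 < m) {g : Spacetime × Spacetime → ℂ}
    (hg : IsRaySuperposition m g) (α : Fin 8 → ℕ) : IsRaySuperposition m (multiD α g) := by
  unfold ThermalField.multiD
  induction List.finRange 8 with
  | nil => exact hg
  | cons i l ih =>
    rw [List.foldr_cons]
    generalize l.foldr (fun i h => (ThermalField.partialD i)^[α i] h) g = f at ih ⊢
    induction α i with
    | zero => exact ih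
    | succ n ihn =>
      rw [Function.iterate_succ_apply']
      exact ihn.partialD hm i

theorem IsRaySuperposition.decay {m : ℝ} (hm : 0 < m) {g : Spacetime × Spacetime → ℂ}
    (hg : IsRaySuperposition m g) {K : Set (Spacetime × Spacetime)} (hK : IsCompact K)
    (hKU : K ⊆ futurePairs) : ∃ C : ℝ, 0 < C ∧ ∀ x y : Spacetime, (x, y) ∈ K → ∀ t : ℝ, 0 < t →
      ‖g (x, (y.1 + t, y.2))‖ ≤ C / t ^ (3 / 2 : ℝ) := by
  obtain ⟨A₁, A₂, h1, h2, h3⟩ := hg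
  obtain ⟨C₁, hC₁, h4⟩ := h1.decay hm hK hKU
  obtain ⟨C₂, hC₂, h5⟩ := h2.decay hm hK hKU
  refine ⟨C₁ + C₂ + 1, by positivity, fun x y hxy t ht => ?_⟩
  rw [h3 (add_time_mem_futurePairs (hKU hxy) ht.le)]
  refine (norm_add_le _ _).trans ?_
  rw [RCLike.norm_conj]
  refine (add_le_add (h4 x y hxy t ht) (h5 x y hxy t ht)).trans ?_
  rw [← add_div]
  exact div_le_div_of_nonneg_right (by linarith) (by positivity)

/-! ### Absolute convergence of the smeared mode integral -/

section Oscillatory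

variable {V : Type} [NormedAddCommGroup V] [NormedSpace ℝ V] [FiniteDimensional ℝ V]
  [MeasurableSpace V] [BorelSpace V] {μ : Measure V} [μ.IsAddHaarMeasure]

lemma mul_integral_exp_mul {l : V →L[ℝ] ℂ} {f : V → ℂ} (hf : ContDiff ℝ ∞ f)
    (hc : HasCompactSupport f) (d : V) :
    l d * ∫ z, Complex.exp (l z) * f z ∂μ = -∫ z, Complex.exp (l z) * fderiv ℝ f z d ∂μ := by
  have hd : ∀ z, HasFDerivAt (fun z => Complex.exp (l z)) (Complex.exp (l z) • l) z :=
    fun z => l.hasFDerivAt.cexp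
  have hcf : Continuous f := hf.continuous
  have hcf' : Continuous fun z => fderiv ℝ f z d :=
    (hf.continuous_fderiv (by simp)).clm_apply continuous_const
  have hc' : HasCompactSupport fun z => fderiv ℝ f z d := hc.fderiv_apply (𝕜 := ℝ) d
  have e1 : ∀ z, fderiv ℝ (fun z => Complex.exp (l z)) z d = l d * Complex.exp (l z) := by
    intro z; rw [(hd z).fderiv]; simp [mul_comm]
  rw [integral_mul_fderiv_eq_neg_fderiv_mul_of_integrable, neg_neg, ← integral_const_mul]
  · simp_rw [e1, mul_assoc]
  · simp_rw [e1]
    exact Continuous.integrable_of_hasCompactSupport (by fun_prop) hc.mul_left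
  · exact Continuous.integrable_of_hasCompactSupport (by fun_prop) hc'.mul_left
  · exact Continuous.integrable_of_hasCompactSupport (by fun_prop) hc.mul_left
  · exact fun z _ => (hd z).differentiableAt
  · exact fun z _ => (hf.differentiable (by simp)).differentiableAt

/-- Decay of oscillatory integrals by repeated integration by parts. -/
lemma exists_pow_mul_norm_integral_exp_le (d : V) (n : ℕ) :
    ∀ {f : V → ℂ}, ContDiff ℝ ∞ f → HasCompactSupport f → ∃ C : ℝ, 0 ≤ C ∧
      ∀ l : V →L[ℝ] ℂ, (∀ z, (l z).re = 0) →
        ‖l d‖ ^ n * ‖∫ z, Complex.exp (l z) * f z ∂μ‖ ≤ C := by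
  induction n with
  | zero =>
    intro f hf hc
    refine ⟨∫ z, ‖f z‖ ∂μ, integral_nonneg fun z => norm_nonneg _, fun l hl => ?_⟩
    rw [pow_zero, one_mul]
    refine (norm_integral_le_integral_norm _).trans (le_of_eq ?_)
    simp [Complex.norm_exp, hl]
  | succ n ih =>
    intro f hf hc
    obtain ⟨C, hC, h⟩ := ih (f := fun z => fderiv ℝ f z d)
      ((hf.fderiv_right (m := ∞) (by simp)).clm_apply contDiff_const)
      (hc.fderiv_apply (𝕜 := ℝ) d)
    refine ⟨C, hC, fun l hl => ?_⟩
    rw [pow_succ, mul_assoc, ← norm_mul, mul_integral_exp_mul hf hc d, norm_neg]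
    exact h l hl

end Oscillatory

instance : (volume : Measure Spacetime).IsAddHaarMeasure :=
  Measure.prod.instIsAddHaarMeasure (volume : Measure ℝ) (volume : Measure Space)

instance : (volume : Measure (Spacetime × Spacetime)).IsAddHaarMeasure :=
  Measure.prod.instIsAddHaarMeasure (volume : Measure Spacetime) (volume : Measure Spacetime)

/-- The exponent of the plane wave with frequency `e` and momentum `k`. -/
def planeForm (e : ℝ) (k : Space) : Spacetime × Spacetime →L[ℝ] ℂ :=
  (-(I * e)) • Complex.ofRealCLM.comp timeDiff +
    I • Complex.ofRealCLM.comp ((innerSL ℝ k).comp spaceDiff)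

lemma planeForm_apply (e : ℝ) (k : Space) (z : Spacetime × Spacetime) :
    planeForm e k z = -(I * e) * timeDiff z + I * (inner ℝ k (spaceDiff z) : ℝ) := rfl

lemma planeForm_re (e : ℝ) (k : Space) (z : Spacetime × Spacetime) :
    (planeForm e k z).re = 0 := by
  simp [planeForm_apply]

lemma energy_pos {m : ℝ} (hm : 0 < m) (k : Space) : 0 < energy m k := by
  unfold energy; positivity

lemma le_energy (m : ℝ) (k : Space) : m ≤ energy m k :=
  Real.le_sqrt_of_sq_le (by nlinarith [sq_nonneg ‖k‖])

lemma norm_le_energy (m : ℝ) (k : Space) : ‖k‖ ≤ energy m k :=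
  Real.le_sqrt_of_sq_le (by nlinarith [sq_nonneg m])

lemma continuous_energy (m : ℝ) : Continuous (energy m) := by
  unfold energy; fun_prop

/-- The coefficient of a mode with amplitude `B`. -/
def modeCoeff (m : ℝ) (B : ℂ → ℂ) (k : Space) : ℂ :=
  B (energy m k : ℝ) / (2 * (energy m k : ℝ))

lemma continuous_modeCoeff {m : ℝ} (hm : 0 < m) {B : ℂ → ℂ} (hB : IsAmplitude m B) :
    Continuous (modeCoeff m B) := by
  unfold modeCoeff
  have h1 : Continuous fun k => ((energy m k : ℝ) : ℂ) :=
    Complex.continuous_ofReal.comp (continuous_energy m)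
  refine Continuous.div ?_ (by fun_prop) fun k => ?_
  · rw [continuous_iff_continuousAt]
    intro k
    exact ContinuousAt.comp (f := fun k => ((energy m k : ℝ) : ℂ))
      (hB.differentiableAt _ (by simpa using le_energy m k)).continuousAt h1.continuousAt
  · have := (energy_pos hm k).ne'
    simpa using this

lemma exists_norm_modeCoeff_le {m : ℝ} (hm : 0 < m) {B : ℂ → ℂ} (hB : IsAmplitude m B) :
    ∃ C : ℝ, 0 ≤ C ∧ ∀ k, ‖modeCoeff m B k‖ ≤ C := by
  obtain ⟨C, hC, h⟩ := hB.bounded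
  refine ⟨C / (2 * m), by positivity, fun k => ?_⟩
  unfold modeCoeff
  have h1 := le_energy m k
  rw [norm_div]
  have h2 : ‖(2 : ℂ) * (energy m k : ℝ)‖ = 2 * energy m k := by
    simp [abs_of_pos (energy_pos hm k)]
  rw [h2]
  exact div_le_div₀ hC (h _ (by simpa using h1)) (by positivity) (by linarith)

/-- The plane waves are written in terms of y - x, so b₊ goes with exp(-iωτ), the factor that decays
in the lower half-plane when τ > 0. -/
lemma thermalMode_eq (m β : ℝ) (k : Space) (z : Spacetime × Spacetime) :
    thermalMode m β k z.1 z.2 =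
      modeCoeff m (bose β) k * Complex.exp (planeForm (energy m k) k z) +
      modeCoeff m (fun w => Complex.exp (-(w * β)) * bose β w) k *
        Complex.exp (planeForm (-energy m k) k z) := by
  have h1 : z.1.2 - z.2.2 = -spaceDiff z := by simp [spaceDiff_apply]
  have h2 : z.1.1 - z.2.1 = -timeDiff z := by simp [timeDiff_apply]
  have e1 : Complex.exp (planeForm (energy m k) k z) =
      Complex.exp (I * (energy m k * -timeDiff z : ℝ)) *
        Complex.exp (-(I * (-inner ℝ k (spaceDiff z) : ℝ))) := by
    rw [← Complex.exp_add, planeForm_apply]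
    congr 1; push_cast; ring
  have e2 : Complex.exp (planeForm (-energy m k) k z) =
      Complex.exp (-(I * (energy m k * -timeDiff z : ℝ))) *
        Complex.exp (-(I * (-inner ℝ k (spaceDiff z) : ℝ))) := by
    rw [← Complex.exp_add, planeForm_apply]
    congr 1; push_cast; ring
  have e3 : bose β (energy m k : ℝ) = (bPlus m β k : ℝ) := by
    simp [bose, bPlus]
  have e4 : Complex.exp (-((energy m k : ℝ) * β)) = (Real.exp (-(β * energy m k)) : ℝ) := by
    push_cast; rw [mul_comm]
  rw [e1, e2]
  simp only [thermalMode, modeCoeff, h1, h2, inner_neg_right, e3, e4, bMinus]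
  push_cast
  ring

lemma continuous_planeForm_apply (σ m : ℝ) :
    Continuous fun q : Space × (Spacetime × Spacetime) =>
      planeForm (σ * energy m q.1) q.1 q.2 := by
  have h := continuous_energy m
  simp only [planeForm_apply]
  fun_prop

lemma continuous_thermalMode {m β : ℝ} (hm : 0 < m) (hβ : 0 < β) :
    Continuous fun q : Space × (Spacetime × Spacetime) => thermalMode m β q.1 q.2.1 q.2.2 := by
  simp only [thermalMode_eq]
  have h1 := continuous_planeForm_apply 1 m
  have h2 := continuous_planeForm_apply (-1) m
  have h3 := continuous_modeCoeff hm (isAmplitude_bose hm hβ)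
  have h4 := continuous_modeCoeff hm (isAmplitude_exp_mul_bose hm hβ)
  simp only [one_mul, neg_mul] at h1 h2
  exact ((h3.comp continuous_fst).mul h1.cexp).add ((h4.comp continuous_fst).mul h2.cexp)

lemma exists_norm_thermalMode_le {m β : ℝ} (hm : 0 < m) (hβ : 0 < β) :
    ∃ C : ℝ, 0 ≤ C ∧ ∀ k (z : Spacetime × Spacetime), ‖thermalMode m β k z.1 z.2‖ ≤ C := by
  obtain ⟨C₁, hC₁, h1⟩ := exists_norm_modeCoeff_le hm (isAmplitude_bose hm hβ)
  obtain ⟨C₂, hC₂, h2⟩ := exists_norm_modeCoeff_le hm (isAmplitude_exp_mul_bose hm hβ)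
  refine ⟨C₁ + C₂, by positivity, fun k z => ?_⟩
  rw [thermalMode_eq]
  refine (norm_add_le _ _).trans ?_
  simp only [norm_mul, Complex.norm_exp, planeForm_re, Real.exp_zero, mul_one]
  exact add_le_add (h1 k) (h2 k)

lemma continuous_smearing {m β : ℝ} (hm : 0 < m) (hβ : 0 < β) {f : Spacetime × Spacetime → ℂ}
    (hf : IsTest f) : Continuous fun q : Space × (Spacetime × Spacetime) =>
      thermalMode m β q.1 q.2.1 q.2.2 * f q.2 :=
  (continuous_thermalMode hm hβ).mul (hf.1.continuous.comp continuous_snd)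

lemma integrable_japanese : Integrable fun k : Space => ((1 + ‖k‖ ^ 2) ^ 2)⁻¹ := by
  have h := integrable_rpow_neg_one_add_norm_sq (E := Space) (μ := volume) (r := 4)
    (by simp; norm_num)
  refine h.congr (Eventually.of_forall fun k => ?_)
  simp only []
  have : (-4 / 2 : ℝ) = -((2 : ℕ) : ℝ) := by norm_num
  rw [this, Real.rpow_neg (by positivity), Real.rpow_natCast]

lemma planeForm_space_direction (e : ℝ) (k : Space) (i : Fin 3) :
    ‖planeForm e k (0, (0, EuclideanSpace.single i 1))‖ = |k i| := by
  simp [planeForm_apply, timeDiff_apply, spaceDiff_apply, EuclideanSpace.inner_single_right]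

/-- Four integrations by parts in each spatial direction of y bound |k_i|⁴ times the integral. Using
only spatial directions makes the bound uniform in e, so e may depend on k. -/
lemma exists_norm_integral_planeForm_le {f : Spacetime × Spacetime → ℂ} (hf : IsTest f) :
    ∃ C : ℝ, 0 ≤ C ∧ ∀ e k, ‖∫ z, Complex.exp (planeForm e k z) * f z‖ ≤
      C * ((1 + ‖k‖ ^ 2) ^ 2)⁻¹ := by
  have h := fun i : Fin 3 => exists_pow_mul_norm_integral_exp_le
    (μ := (volume : Measure (Spacetime × Spacetime)))
    ((0, (0, EuclideanSpace.single i 1)) : Spacetime × Spacetime) 4 hf.1 hf.2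
  choose C hC h using h
  obtain ⟨D, hD, h0⟩ := exists_pow_mul_norm_integral_exp_le
    (μ := (volume : Measure (Spacetime × Spacetime)))
    (0 : Spacetime × Spacetime) 0 hf.1 hf.2
  refine ⟨4 * (D + C 0 + C 1 + C 2), by have := hC 0; have := hC 1; have := hC 2; positivity,
    fun e k => ?_⟩
  have h1 := fun i => h i (planeForm e k) (planeForm_re e k)
  have h2 := h0 (planeForm e k) (planeForm_re e k)
  simp only [planeForm_space_direction] at h1
  rw [pow_zero, one_mul] at h2
  set J := ‖∫ z, Complex.exp (planeForm e k z) * f z‖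
  have hJ : 0 ≤ J := norm_nonneg _
  rw [← div_eq_mul_inv, le_div_iff₀ (by positivity), EuclideanSpace.real_norm_sq_eq,
    Fin.sum_univ_three]
  have e0 : ∀ i, |k i| ^ 4 = (k i ^ 2) ^ 2 := fun i => by
    rw [← sq_abs (k i)]; ring
  simp only [e0] at h1
  -- Cauchy–Schwarz for a sum of four terms.
  have e1 : (1 + (k 0 ^ 2 + k 1 ^ 2 + k 2 ^ 2)) ^ 2 ≤
      4 * (1 + (k 0 ^ 2) ^ 2 + (k 1 ^ 2) ^ 2 + (k 2 ^ 2) ^ 2) := by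
    generalize k 0 ^ 2 = a
    generalize k 1 ^ 2 = b
    generalize k 2 ^ 2 = c
    nlinarith [sq_nonneg (a - b), sq_nonneg (a - c), sq_nonneg (b - c), sq_nonneg (a - 1),
      sq_nonneg (b - 1), sq_nonneg (c - 1)]
  calc _ ≤ J * (4 * (1 + (k 0 ^ 2) ^ 2 + (k 1 ^ 2) ^ 2 + (k 2 ^ 2) ^ 2)) :=
        mul_le_mul_of_nonneg_left e1 hJ
    _ = 4 * (J + (k 0 ^ 2) ^ 2 * J + (k 1 ^ 2) ^ 2 * J + (k 2 ^ 2) ^ 2 * J) := by ring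
    _ ≤ _ := by linarith [h1 0, h1 1, h1 2]

lemma smearedMode_eq {m β : ℝ} {f : Spacetime × Spacetime → ℂ} (hf : IsTest f) (k : Space) :
    smearedMode m β f k =
      modeCoeff m (bose β) k * (∫ z, Complex.exp (planeForm (energy m k) k z) * f z) +
      modeCoeff m (fun w => Complex.exp (-(w * β)) * bose β w) k *
        ∫ z, Complex.exp (planeForm (-energy m k) k z) * f z := by
  have hcf := hf.1.continuous
  have hi : ∀ e, Integrable fun z => Complex.exp (planeForm e k z) * f z := fun e =>
    Continuous.integrable_of_hasCompactSupport (by fun_prop) hf.2.mul_left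
  rw [← integral_const_mul, ← integral_const_mul,
    ← integral_add ((hi _).const_mul _) ((hi _).const_mul _)]
  unfold smearedMode
  refine integral_congr_ae (Eventually.of_forall fun z => ?_)
  simp only [thermalMode_eq]
  ring

lemma stronglyMeasurable_smearedMode {m β : ℝ} (hm : 0 < m) (hβ : 0 < β)
    {f : Spacetime × Spacetime → ℂ} (hf : IsTest f) :
    StronglyMeasurable (smearedMode m β f) :=
  (continuous_smearing hm hβ hf).stronglyMeasurable.integral_prod_right

/-- The mode integral of the smeared two-point function converges absolutely. -/
theorem integrable_smearedMode {m β : ℝ} (hm : 0 < m) (hβ : 0 < β)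
    {f : Spacetime × Spacetime → ℂ} (hf : IsTest f) : Integrable (smearedMode m β f) := by
  obtain ⟨C₁, hC₁, h1⟩ := exists_norm_modeCoeff_le hm (isAmplitude_bose hm hβ)
  obtain ⟨C₂, hC₂, h2⟩ := exists_norm_modeCoeff_le hm (isAmplitude_exp_mul_bose hm hβ)
  obtain ⟨D, hD, h⟩ := exists_norm_integral_planeForm_le hf
  refine (integrable_japanese.const_mul ((C₁ + C₂) * D)).mono'
    (stronglyMeasurable_smearedMode hm hβ hf).aestronglyMeasurable
    (Eventually.of_forall fun k => ?_)
  rw [smearedMode_eq hf]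
  refine (norm_add_le _ _).trans ?_
  rw [norm_mul, norm_mul]
  calc _ ≤ C₁ * (D * ((1 + ‖k‖ ^ 2) ^ 2)⁻¹) + C₂ * (D * ((1 + ‖k‖ ^ 2) ^ 2)⁻¹) := by
        gcongr
        exacts [h1 k, h _ _, h2 k, h _ _]
    _ = _ := by ring

/-! ### Damped modes and removal of the damping -/

/-- The amplitude on the rays arising from `B` by rotation of the energy contour, damped by
`exp (-ε ω)`. -/
def rayAmplitude (m : ℝ) (B : ℂ → ℂ) (ε : ℝ) (l : Metric.sphere (0 : Space) 1 × ℝ) : ℂ :=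
  -I * (1 / 2 * momentum m (-(l.2 * I)) * B (m - l.2 * I)) * Complex.exp (-ε * (m - l.2 * I))

/-- A bound for `rayAmplitude` uniform in the damping. -/
def rayBound (C : ℝ) (l : Metric.sphere (0 : Space) 1 × ℝ) : ℂ :=
  (C * (Real.sqrt l.2 * (1 + l.2)) : ℝ)

lemma isRayAmplitude_rayBound {C : ℝ} (hC : 0 ≤ C) : IsRayAmplitude (rayBound C) := by
  refine ⟨Continuous.aestronglyMeasurable (by unfold rayBound; fun_prop), C, 1, hC,
    fun l hl => le_of_eq ?_⟩
  unfold rayBound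
  rw [Complex.norm_real, Real.norm_of_nonneg (by positivity)]
  ring

lemma measurable_rayAmplitude {m : ℝ} {B : ℂ → ℂ} (hB : IsAmplitude m B) (ε : ℝ) :
    Measurable (rayAmplitude m B ε) := by
  have h1 := measurable_momentum m
  have h2 := hB.measurable
  unfold rayAmplitude
  fun_prop

lemma exists_norm_rayAmplitude_le {m : ℝ} (hm : 0 < m) {B : ℂ → ℂ} (hB : IsAmplitude m B) :
    ∃ C : ℝ, 0 ≤ C ∧ ∀ ε : ℝ, 0 ≤ ε → ∀ l : Metric.sphere (0 : Space) 1 × ℝ, 0 < l.2 →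
      ‖rayAmplitude m B ε l‖ ≤ ‖rayBound C l‖ := by
  obtain ⟨C, hC, h⟩ := hB.bounded
  refine ⟨(2 * m + 1) * C, by positivity, fun ε hε l hl => ?_⟩
  unfold rayAmplitude rayBound
  rw [Complex.norm_real, Real.norm_of_nonneg (by positivity)]
  have h1 := norm_momentum_vertical_le hm hl.le
  have h2 : ‖Complex.exp (-ε * (m - l.2 * I))‖ ≤ 1 := by
    rw [Complex.norm_exp, Real.exp_le_one_iff]
    simp; positivity
  have h3 := h (m - l.2 * I) (by simp)
  rw [norm_mul, norm_mul, norm_mul, norm_mul, norm_neg, norm_I, one_mul]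
  calc _ ≤ 1 * (Real.sqrt l.2 * (l.2 + 2 * m + 1)) * C * 1 := by
        gcongr
        norm_num
    _ ≤ 1 * (Real.sqrt l.2 * ((2 * m + 1) * (1 + l.2))) * C * 1 := by
        gcongr
        nlinarith
    _ = _ := by ring

lemma isRayAmplitude_rayAmplitude {m : ℝ} (hm : 0 < m) {B : ℂ → ℂ} (hB : IsAmplitude m B)
    {ε : ℝ} (hε : 0 ≤ ε) : IsRayAmplitude (rayAmplitude m B ε) := by
  obtain ⟨C, hC, h⟩ := exists_norm_rayAmplitude_le hm hB
  obtain ⟨-, C', N, hC', h'⟩ := isRayAmplitude_rayBound hC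
  exact ⟨(measurable_rayAmplitude hB ε).aestronglyMeasurable, C', N, hC',
    fun l hl => (h ε hε l hl).trans (h' l hl)⟩

/-- The superposition of rays for the amplitude `B`. -/
def raySum (m : ℝ) (B : ℂ → ℂ) (ε : ℝ) : Spacetime × Spacetime → ℂ :=
  expIntegral rayMeasure (rayForm m) (rayAmplitude m B ε)

lemma raySum_tendsto {m : ℝ} (hm : 0 < m) {B : ℂ → ℂ} (hB : IsAmplitude m B)
    {z : Spacetime × Spacetime} (hz : z ∈ futurePairs) :
    Tendsto (fun ε => raySum m B ε z) (𝓝[>] 0) (𝓝 (raySum m B 0 z)) := by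
  obtain ⟨C, hC, h⟩ := exists_norm_rayAmplitude_le hm hB
  have hD := ((isRayAmplitude_rayBound hC).isTame hm).integrable hz
  refine tendsto_integral_filter_of_dominated_convergence
    (fun l => ‖Complex.exp (rayForm m l z) • rayBound C l‖) ?_ ?_ hD.norm ?_
  · exact Eventually.of_forall fun ε => aestronglyMeasurable_exp_smul
      (stronglyMeasurable_rayForm m).aestronglyMeasurable
      (measurable_rayAmplitude hB ε).aestronglyMeasurable z
  · filter_upwards [self_mem_nhdsWithin] with ε hε
    filter_upwards [ae_rayMeasure] with l hl
    rw [norm_smul, norm_smul]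
    exact mul_le_mul_of_nonneg_left (h ε (le_of_lt hε) l hl) (norm_nonneg _)
  · refine Eventually.of_forall fun l => Tendsto.const_smul ?_ _
    refine Tendsto.mono_left ?_ nhdsWithin_le_nhds
    have : Continuous fun ε => rayAmplitude m B ε l := by unfold rayAmplitude; fun_prop
    exact this.tendsto 0

/-- Uniformity in ε supplies the dominating function for ε → 0 under the integral over spacetime
pairs. -/
lemma exists_norm_raySum_le {m : ℝ} (hm : 0 < m) {B : ℂ → ℂ} (hB : IsAmplitude m B)
    {K : Set (Spacetime × Spacetime)} (hK : IsCompact K) (hKU : K ⊆ futurePairs) :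
    ∃ C : ℝ, 0 ≤ C ∧ ∀ ε : ℝ, 0 ≤ ε → ∀ z ∈ K, ‖raySum m B ε z‖ ≤ C := by
  obtain ⟨C, hC, h⟩ := exists_norm_rayAmplitude_le hm hB
  obtain ⟨δ, R, hδ, hz⟩ := exists_gap hK hKU
  obtain ⟨D, hD, hL⟩ := exists_norm_rayForm_le hm
  obtain ⟨G, hG, hb⟩ := (isRayAmplitude_rayBound hC).norm_mul_exp_le hm hD hL 0 (half_pos hδ) R
  have hi : Integrable (fun l : Metric.sphere (0 : Space) 1 × ℝ =>
      G * (Real.sqrt l.2 * Real.exp (-(δ / 2 * l.2)))) rayMeasure :=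
    (integrable_rayMeasure_snd (integrableOn_sqrt_mul_exp (half_pos hδ))).const_mul G
  refine ⟨∫ l, G * (Real.sqrt l.2 * Real.exp (-(δ / 2 * l.2))) ∂rayMeasure,
    integral_nonneg fun l => by positivity, fun ε hε z hzK => norm_integral_le_of_norm_le hi ?_⟩
  filter_upwards [ae_rayMeasure] with l hl
  have := hb l hl z (δ / 2) (by linarith [(hz z hzK).1]) (hz z hzK).2
  rw [pow_zero, mul_one] at this
  refine le_trans ?_ this
  rw [norm_smul, Complex.norm_exp, mul_comm]
  exact mul_le_mul_of_nonneg_right (h ε hε l hl) (Real.exp_pos _).le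

lemma integrable_exp_neg_energy (m : ℝ) {ε : ℝ} (hε : 0 < ε) :
    Integrable fun k : Space => Real.exp (-(ε * energy m k)) := by
  obtain ⟨C, hC, h⟩ := exists_pow_le_exp 4 hε
  have hc := continuous_energy m
  refine (integrable_japanese.const_mul C).mono'
    (Continuous.aestronglyMeasurable (by fun_prop)) (Eventually.of_forall fun k => ?_)
  rw [Real.norm_of_nonneg (Real.exp_pos _).le, ← div_eq_mul_inv, le_div_iff₀ (by positivity)]
  have h1 : (1 + ‖k‖ ^ 2) ^ 2 ≤ (1 + ‖k‖) ^ 4 := by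
    have : (1 + ‖k‖ ^ 2) ≤ (1 + ‖k‖) ^ 2 := by nlinarith [norm_nonneg k]
    calc _ ≤ ((1 + ‖k‖) ^ 2) ^ 2 := by gcongr
      _ = _ := by ring
  calc _ ≤ Real.exp (-(ε * energy m k)) * (C * Real.exp (ε * energy m k)) := by
        gcongr
        refine h1.trans ((h _ (norm_nonneg k)).trans ?_)
        gcongr
        exact norm_le_energy m k
    _ = C * (Real.exp (-(ε * energy m k)) * Real.exp (ε * energy m k)) := by ring
    _ = C := by rw [← Real.exp_add]; simp

/-- A mode with amplitude `B` and frequency of sign `σ`, damped by `exp (-ε ω)`. -/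
def dampedMode (m : ℝ) (B : ℂ → ℂ) (ε σ : ℝ) (z : Spacetime × Spacetime) (k : Space) : ℂ :=
  (Real.exp (-(ε * energy m k)) : ℝ) *
    (modeCoeff m B k * Complex.exp (planeForm (σ * energy m k) k z))

lemma integrable_dampedMode {m : ℝ} (hm : 0 < m) {B : ℂ → ℂ} (hB : IsAmplitude m B)
    {ε : ℝ} (hε : 0 < ε) (σ : ℝ) (z : Spacetime × Spacetime) :
    Integrable (dampedMode m B ε σ z) := by
  obtain ⟨C, hC, h⟩ := exists_norm_modeCoeff_le hm hB
  have hc := continuous_energy m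
  have hc2 := continuous_modeCoeff hm hB
  have hc3 : Continuous fun k => planeForm (σ * energy m k) k z :=
    (continuous_planeForm_apply σ m).comp (f := fun k => (k, z)) (by fun_prop)
  refine ((integrable_exp_neg_energy m hε).mul_const C).mono'
    (Continuous.aestronglyMeasurable (by unfold dampedMode; fun_prop))
    (Eventually.of_forall fun k => ?_)
  unfold dampedMode
  rw [norm_mul, norm_mul, Complex.norm_real, Real.norm_of_nonneg (Real.exp_pos _).le,
    Complex.norm_exp, planeForm_re, Real.exp_zero, mul_one]
  exact mul_le_mul_of_nonneg_left (h k) (Real.exp_pos _).le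

/-- Rotation of the energy contour for the damped mode integral. -/
theorem integral_dampedMode {m : ℝ} (hm : 0 < m) {B : ℂ → ℂ} (hB : IsAmplitude m B)
    {ε : ℝ} (hε : 0 < ε) {z : Spacetime × Spacetime} (hz : z ∈ futurePairs) :
    ∫ k, dampedMode m B ε 1 z k = raySum m B ε z := by
  rw [integral_polar (integrable_dampedMode hm hB hε 1 z)]
  unfold raySum expIntegral
  have hi := ((isRayAmplitude_rayAmplitude hm hB hε.le).isTame hm).integrable hz
  unfold rayMeasure at hi ⊢
  rw [integral_prod _ hi]
  refine integral_congr_ae (Eventually.of_forall fun n => ?_)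
  simp only []
  have hs : |inner ℝ (n : Space) (spaceDiff z)| < timeDiff z := by
    refine lt_of_le_of_lt ?_ ((mem_futurePairs_iff z).1 hz)
    simpa using abs_real_inner_le_norm (n : Space) (spaceDiff z)
  have h := integral_radial hm hB hε hs
  rw [← integral_const_mul] at h
  refine Eq.trans ?_ (h.trans ?_)
  · refine setIntegral_congr_fun measurableSet_Ioi fun p hp => ?_
    have hp : 0 < p := hp
    have hE : energy m (p • (n : Space)) = Real.sqrt (p ^ 2 + m ^ 2) := by
      simp [energy, norm_smul]
    simp only [dampedMode, modeCoeff, hE, planeForm_apply, real_inner_smul_left, one_mul]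
    congr 1
    rw [Complex.ofReal_exp, mul_left_comm, ← Complex.exp_add]
    congr 2
    push_cast
    ring
  · refine integral_congr_ae (Eventually.of_forall fun u => ?_)
    simp only [radialFun, rayAmplitude, rayForm_apply, smul_eq_mul]
    have e1 : (m : ℂ) + -(u * I) = m - u * I := by ring
    rw [e1]
    have e2 : Complex.exp (-(ε + timeDiff z * I) * (m - u * I) +
        I * momentum m (-(u * I)) * (inner ℝ (n : Space) (spaceDiff z) : ℝ)) =
        Complex.exp (-ε * (m - u * I)) * Complex.exp (-(I * (m - u * I)) * timeDiff z +
        I * momentum m (-(u * I)) * (inner ℝ (n : Space) (spaceDiff z) : ℝ)) := by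
      rw [← Complex.exp_add]; congr 1; ring
    rw [e2]
    ring

lemma energy_neg (m : ℝ) (k : Space) : energy m (-k) = energy m k := by simp [energy]

/-- Complex conjugation followed by k ↦ -k reverses only the sign of the frequency when the
amplitude is real on real energies. A second rotation, into the upper quadrant, is thus avoided. -/
theorem integral_dampedMode_neg {m : ℝ} {B : ℂ → ℂ}
    (hreal : ∀ e : ℝ, (starRingEnd ℂ) (B e) = B e)
    (ε : ℝ) (z : Spacetime × Spacetime) :
    ∫ k, dampedMode m B ε (-1) z k = (starRingEnd ℂ) (∫ k, dampedMode m B ε 1 z k) := by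
  rw [← integral_conj, ← integral_neg_eq_self]
  refine integral_congr_ae (Eventually.of_forall fun k => ?_)
  simp only [dampedMode, modeCoeff, energy_neg, map_mul, map_div₀, hreal, Complex.conj_ofReal,
    ← Complex.exp_conj, planeForm_apply, map_add, map_neg, Complex.conj_I, inner_neg_left,
    map_ofNat]
  congr 3
  push_cast
  ring

lemma conj_bose (β e : ℝ) : (starRingEnd ℂ) (bose β e) = bose β e := by
  simp [bose, ← Complex.exp_conj]

/-! ### Identification of the two-point function -/

/-- The damped two-point function, up to normalization. -/
def dampedTwoPoint (m β ε : ℝ) (z : Spacetime × Spacetime) : ℂ :=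
  raySum m (bose β) ε z +
    (starRingEnd ℂ) (raySum m (fun w => Complex.exp (-(w * β)) * bose β w) ε z)

lemma integral_exp_mul_thermalMode {m β : ℝ} (hm : 0 < m) (hβ : 0 < β) {ε : ℝ} (hε : 0 < ε)
    {z : Spacetime × Spacetime} (hz : z ∈ futurePairs) :
    ∫ k, (Real.exp (-(ε * energy m k)) : ℝ) * thermalMode m β k z.1 z.2 =
      dampedTwoPoint m β ε z := by
  have hB₁ := isAmplitude_bose hm hβ
  have hB₂ := isAmplitude_exp_mul_bose hm hβ
  unfold dampedTwoPoint
  rw [← integral_dampedMode hm hB₁ hε hz, ← integral_dampedMode hm hB₂ hε hz,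
    ← integral_dampedMode_neg (fun e => by simp [conj_bose, ← Complex.exp_conj]),
    ← integral_add (integrable_dampedMode hm hB₁ hε _ z) (integrable_dampedMode hm hB₂ hε _ z)]
  refine integral_congr_ae (Eventually.of_forall fun k => ?_)
  simp only [thermalMode_eq, dampedMode, one_mul, neg_mul, mul_add]

lemma integrable_damped_smearing {m β : ℝ} (hm : 0 < m) (hβ : 0 < β) {ε : ℝ} (hε : 0 < ε)
    {f : Spacetime × Spacetime → ℂ} (hf : IsTest f) :
    Integrable (fun q : Space × (Spacetime × Spacetime) =>
      ((Real.exp (-(ε * energy m q.1)) : ℝ) : ℂ) * (thermalMode m β q.1 q.2.1 q.2.2 * f q.2))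
      ((volume : Measure Space).prod (volume : Measure (Spacetime × Spacetime))) := by
  obtain ⟨C, hC, h⟩ := exists_norm_thermalMode_le hm hβ
  have hfi : Integrable f := hf.1.continuous.integrable_of_hasCompactSupport hf.2
  have hc := continuous_energy m
  have hc2 := continuous_smearing hm hβ hf
  refine ((integrable_exp_neg_energy m hε).mul_prod (hfi.norm.const_mul C)).mono'
    (Continuous.aestronglyMeasurable (Continuous.mul (by fun_prop) hc2))
    (Eventually.of_forall fun q => ?_)
  rw [norm_mul, norm_mul, Complex.norm_real, Real.norm_of_nonneg (Real.exp_pos _).le]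
  gcongr
  exact h _ _

/-- The two-point function on future timelike pairs is a superposition of ray exponentials. -/
theorem integral_smearedMode_eq {m β : ℝ} (hm : 0 < m) (hβ : 0 < β)
    {f : Spacetime × Spacetime → ℂ} (hf : IsTest f) (hfs : tsupport f ⊆ futurePairs) :
    ∫ k, smearedMode m β f k = ∫ z, dampedTwoPoint m β 0 z * f z := by
  have hB₁ := isAmplitude_bose hm hβ
  have hB₂ := isAmplitude_exp_mul_bose hm hβ
  have hfi : Integrable f := hf.1.continuous.integrable_of_hasCompactSupport hf.2
  have hsm := integrable_smearedMode hm hβ hf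
  have lim1 : Tendsto (fun ε : ℝ => ∫ k, ((Real.exp (-(ε * energy m k)) : ℝ) : ℂ) *
      smearedMode m β f k) (𝓝[>] 0) (𝓝 (∫ k, smearedMode m β f k)) := by
    have hc := continuous_energy m
    refine tendsto_integral_filter_of_dominated_convergence (fun k => ‖smearedMode m β f k‖)
      ?_ ?_ hsm.norm ?_
    · exact Eventually.of_forall fun ε =>
        (Continuous.aestronglyMeasurable (by fun_prop)).mul hsm.aestronglyMeasurable
    · filter_upwards [self_mem_nhdsWithin] with ε hε
      refine Eventually.of_forall fun k => ?_
      rw [norm_mul, Complex.norm_real, Real.norm_of_nonneg (Real.exp_pos _).le]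
      refine mul_le_of_le_one_left (norm_nonneg _) ?_
      rw [Real.exp_le_one_iff, neg_nonpos]
      exact mul_nonneg (le_of_lt hε) (energy_pos hm k).le
    · refine Eventually.of_forall fun k => Tendsto.mono_left ?_ nhdsWithin_le_nhds
      have : Continuous fun ε : ℝ => ((Real.exp (-(ε * energy m k)) : ℝ) : ℂ) *
        smearedMode m β f k := by fun_prop
      simpa using this.tendsto 0
  have heq : ∀ ε : ℝ, 0 < ε → ∀ z, ∫ k, ((Real.exp (-(ε * energy m k)) : ℝ) : ℂ) *
      (thermalMode m β k z.1 z.2 * f z) = dampedTwoPoint m β ε z * f z := by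
    intro ε hε z
    by_cases hz : z ∈ tsupport f
    · rw [← integral_exp_mul_thermalMode hm hβ hε (hfs hz), ← integral_mul_const]
      simp_rw [mul_assoc]
    · simp [image_eq_zero_of_notMem_tsupport hz]
  -- The damping makes the integrand absolutely integrable jointly in momentum and position.
  have fub : ∀ ε : ℝ, 0 < ε → ∫ k, ((Real.exp (-(ε * energy m k)) : ℝ) : ℂ) *
      smearedMode m β f k = ∫ z, dampedTwoPoint m β ε z * f z := by
    intro ε hε
    simp_rw [← heq ε hε, smearedMode, ← integral_const_mul]
    exact integral_integral_swap (integrable_damped_smearing hm hβ hε hf)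
  have lim2 : Tendsto (fun ε : ℝ => ∫ z, dampedTwoPoint m β ε z * f z) (𝓝[>] 0)
      (𝓝 (∫ z, dampedTwoPoint m β 0 z * f z)) := by
    obtain ⟨C₁, hC₁, h1⟩ := exists_norm_raySum_le hm hB₁ hf.2 hfs
    obtain ⟨C₂, hC₂, h2⟩ := exists_norm_raySum_le hm hB₂ hf.2 hfs
    refine tendsto_integral_filter_of_dominated_convergence (fun z => (C₁ + C₂) * ‖f z‖)
      ?_ ?_ (hfi.norm.const_mul _) ?_
    · filter_upwards [self_mem_nhdsWithin] with ε hε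
      -- Measurability in z is read off from the momentum integral, by Fubini.
      simp_rw [← heq ε hε]
      exact (integrable_damped_smearing hm hβ hε hf).integral_prod_right.aestronglyMeasurable
    · filter_upwards [self_mem_nhdsWithin] with ε hε
      refine Eventually.of_forall fun z => ?_
      by_cases hz : z ∈ tsupport f
      · rw [norm_mul]
        refine mul_le_mul_of_nonneg_right ((norm_add_le _ _).trans ?_) (norm_nonneg _)
        rw [RCLike.norm_conj]
        exact add_le_add (h1 ε (le_of_lt hε) z hz) (h2 ε (le_of_lt hε) z hz)
      · simp [image_eq_zero_of_notMem_tsupport hz]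
    · refine Eventually.of_forall fun z => ?_
      by_cases hz : z ∈ tsupport f
      · refine Tendsto.mul_const _ ((raySum_tendsto hm hB₁ (hfs hz)).add ?_)
        exact (Complex.continuous_conj.tendsto _).comp (raySum_tendsto hm hB₂ (hfs hz))
      · simp [image_eq_zero_of_notMem_tsupport hz]
  refine tendsto_nhds_unique lim1 (lim2.congr' ?_)
  filter_upwards [self_mem_nhdsWithin] with ε hε
  exact (fub ε hε).symm

lemma isRaySuperposition_dampedTwoPoint {m β : ℝ} (hm : 0 < m) (hβ : 0 < β) (c : ℝ) :
    IsRaySuperposition m (fun z => c * dampedTwoPoint m β 0 z) := by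
  have key : ∀ {A : Metric.sphere (0 : Space) 1 × ℝ → ℂ}, IsRayAmplitude A →
      IsRayAmplitude fun l => (c : ℂ) * A l := by
    rintro A ⟨h1, C, N, hC, h2⟩
    refine ⟨h1.const_mul _, |c| * C, N, by positivity, fun l hl => ?_⟩
    rw [norm_mul, Complex.norm_real, Real.norm_eq_abs, mul_assoc, mul_assoc, ← mul_assoc C]
    exact mul_le_mul_of_nonneg_left (h2 l hl) (abs_nonneg c)
  refine ⟨_, _, key (isRayAmplitude_rayAmplitude hm (isAmplitude_bose hm hβ) le_rfl),
    key (isRayAmplitude_rayAmplitude hm (isAmplitude_exp_mul_bose hm hβ) le_rfl), fun z _ => ?_⟩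
  have e : ∀ A : Metric.sphere (0 : Space) 1 × ℝ → ℂ,
      expIntegral rayMeasure (rayForm m) (fun l => (c : ℂ) * A l) z =
        c * expIntegral rayMeasure (rayForm m) A z := by
    intro A
    unfold expIntegral
    rw [← integral_const_mul]
    simp only [smul_eq_mul, mul_left_comm]
  simp only [e, map_mul, Complex.conj_ofReal, dampedTwoPoint, raySum, mul_add]

end ThermalField

end

theorem mainTheorem9 (m β : ℝ) (hm : 0 < m) (hβ : 0 < β) :
    (∀ f : ThermalField.Spacetime × ThermalField.Spacetime → ℂ, ThermalField.IsTest f →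
      Integrable (ThermalField.smearedMode m β f)) ∧
    ∃ w : ThermalField.Spacetime × ThermalField.Spacetime → ℂ,
      ContDiffOn ℝ ∞ w ThermalField.futurePairs ∧
      (∀ f : ThermalField.Spacetime × ThermalField.Spacetime → ℂ, ThermalField.IsTest f →
        tsupport f ⊆ ThermalField.futurePairs →
        ThermalField.thermalTwoPoint m β f = ∫ z, w z * f z) ∧
      ∀ (α : Fin 8 → ℕ) (K : Set (ThermalField.Spacetime × ThermalField.Spacetime)),
        IsCompact K → K ⊆ ThermalField.futurePairs →
        ∃ C : ℝ, 0 < C ∧ ∀ x y : ThermalField.Spacetime, (x, y) ∈ K → ∀ t : ℝ, 1 < t →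
          ‖ThermalField.multiD α w (x, (y.1 + t, y.2))‖ ≤ C / t ^ (3 / 2 : ℝ) := by
  refine ⟨fun f hf => ThermalField.integrable_smearedMode hm hβ hf, ?_⟩
  -- The smooth representative is the undamped ray superposition, with the normalization (2π)⁻³
  -- absorbed into its amplitudes.
  have h := ThermalField.isRaySuperposition_dampedTwoPoint hm hβ (1 / (2 * Real.pi) ^ 3)
  refine ⟨_, h.contDiffOn hm, fun f hf hfs => ?_, fun α K hK hKU => ?_⟩
  · rw [ThermalField.thermalTwoPoint, ThermalField.integral_smearedMode_eq hm hβ hf hfs,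
      ← integral_const_mul]
    simp only [mul_assoc]
  · obtain ⟨C, hC, hb⟩ := (h.multiD hm α).decay hm hK hKU
    exact ⟨C, hC, fun x y hxy t ht => hb x y hxy t (by linarith)⟩
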